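/- For $L=(l_1,\dots,l_4)$ with $l_i>0$, $l_1+\dots+l_4=1$, let $T=T_L:[0,1)\to[0,1)$ be the 4-interval exchange transformation (IET) with lengths $L$ and permutation $(4213)$: the intervals $I_j=[l_1+\dots+l_{j-1},\,l_1+\dots+l_j)$, $1\le j\le 4$, are translated by $T$ so that $I_4$ is placed first, $I_2$ second, $I_1$ third and $I_3$ last. For integers $m,n\ge 1$ let $$A_{m,n}=\begin{pmatrix}0&0&1&1\\ m-1&m&0&0\\ n&n&n-1&n\\ 1&1&1&1\end{pmatrix}.$$ Call $T$ a Keane IET with parameters $(m_k,n_k)_{k\ge0}$, $m_k,n_k\ge1$, if there are half-open intervals $I_j^{(k)}$ ($k\ge 0$, $1\le j\le4$) of lengths $\ell_j^{(k)}>0$ and integers $b_{k,j}$ such that, with $I^{(k)}=\bigcup_j I_j^{(k)}$: $I_j^{(0)}=I_j$; $I^{(k+1)}=I_4^{(k)}$; the intervals $I_1^{(k)},\dots,I_4^{(k)}$ are ordered from left to right if $k$ is even and from right to left if $k$ is odd; every point of $I_j^{(k)}$ has first return time $b_{k,j}$ to $I^{(k)}$ under $T$; the first return map of $T$ to $I^{(k)}$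 is the IET of the intervals $I_j^{(k)}$ with permutation $(4213)$ (read from right to left if $k$ is odd); $\ell^{(k)}=A_{m_k,n_k}\ell^{(k+1)}$; and every point of $I_j^{(k+1)}$ visits $I_i^{(k)}$ exactly $(A_{m_k,n_k})_{ij}$ times at the times $0\le t<b_{k+1,j}$. **Theorem 1.** There exists a topologically mixing 4-IET. More precisely, there are lengths $L$ and parameters $(m_k,n_k)_{k\ge0}$ such that $T=T_L$ is a Keane IET with these parameters, its return times satisfy, for all $k\ge1$, 1. $b_{k,2}$ is prime; 2. $b_{i,2}\nmid b_{k,3}$ for all $1\le i<k$; 3. the group of units modulo $\prod_{i=1}^k b_{i,2}$ has more than $\frac12\prod_{i=1}^k b_{i,2}$ elements; 4. $b_{k,2}b_{k+1,3}+b_{k+1,3}+b_{k,4}+b_{k-1,4}<m_kb_{k,2}$; 5. $b_{k,3}b_{k,2}+b_{k,2}<n_kb_{k,3}$; and $T$ is topologically mixing: for any two nonempty open sets $U,V\subseteq[0,1)$ there is $N$ such that $T^n(U)\cap V\ne\emptyset$ for all $n\ge N$. Moreover, the symbolic topology on $[0,1)$, generated by the sets $\{x: T^nx\in I_j\}$ ($n\in\mathbb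 Z$, $1\le j\le 4$), is finer than the standard topology, $T$ is continuous in it, and $T$ is topologically mixing with respect to it as well. -/

import Mathlib

noncomputable section

/-- The unit interval `[0, 1)` with its standard (subspace) topology. -/
abbrev UnitIco : Type := Set.Ico (0 : ℝ) 1

/-- A map `T` of a topological space is topologically mixing if for all nonempty open `U`, `V`
there is `N` with `T^n(U) ∩ V ≠ ∅` for all `n ≥ N`. (Continuity of `T` is not required.) -/
def TopologicallyMixing {X : Type*} [TopologicalSpace X] (T : X → X) : Prop :=
  ∀ U V : Set X, IsOpen U → IsOpen V → U.Nonempty → V.Nonempty →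
    ∃ N : ℕ, ∀ n ≥ N, (T^[n] '' U ∩ V).Nonempty

/-- The open simplex of length vectors `(l_1, …, l_n)`, `l_i > 0`, `l_1 + … + l_n = 1`
(indices run over `0, …, n - 1`). -/
abbrev LengthVector (n : ℕ) : Type :=
  {l : Fin n → ℝ // (∀ i, 0 < l i) ∧ ∑ i, l i = 1}

namespace LengthVector

variable {n : ℕ}

/-- The left endpoint `∑_{k < j} l_k` of the `j`-th subinterval. -/
def leftEnd (L : LengthVector n) (j : Fin n) : ℝ := ∑ k with k < j, L.1 k

/-- The `j`-th subinterval `I_j = [∑_{k < j} l_k, ∑_{k < j} l_k + l_j)` of `[0, 1)`. -/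
def piece (L : LengthVector n) (j : Fin n) : Set UnitIco :=
  {x | L.leftEnd j ≤ (x : ℝ) ∧ (x : ℝ) < L.leftEnd j + L.1 j}

theorem exists_mem_piece (L : LengthVector n) (x : UnitIco) : ∃ j, x ∈ L.piece j := by
  classical
  have hex : ∃ i : ℕ, (x : ℝ) < ∑ k ∈ Finset.univ.filter (fun k : Fin n => (k : ℕ) < i), L.1 k := by
    refine ⟨n, ?_⟩
    have : (Finset.univ.filter fun k : Fin n => (k : ℕ) < n) = Finset.univ := by
      ext k; simp
    rw [this, L.2.2]
    exact x.2.2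
  have hs := Nat.find_spec hex
  have hm := fun {i : ℕ} (h : i < Nat.find hex) => Nat.find_min hex h
  generalize Nat.find hex = i at hs hm
  have hx0 : (0 : ℝ) ≤ x := x.2.1
  cases i with
  | zero => simp at hs; linarith
  | succ i =>
    have h1 := not_lt.mp (hm (Nat.lt_succ_self i))
    by_cases hi : i < n
    · refine ⟨⟨i, hi⟩, ?_, ?_⟩
      · exact h1
      · have : (Finset.univ.filter fun k : Fin n => (k : ℕ) < i + 1)
            = insert ⟨i, hi⟩ (Finset.univ.filter fun k : Fin n => k < ⟨i, hi⟩) := by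
          ext k
          simp only [Finset.mem_filter, Finset.mem_univ, true_and, Finset.mem_insert,
            Fin.lt_def, Fin.ext_iff]
          omega
        rw [this, Finset.sum_insert (by simp), add_comm] at hs
        exact hs
    · exfalso
      have : (Finset.univ.filter fun k : Fin n => (k : ℕ) < i + 1)
          = Finset.univ.filter fun k : Fin n => (k : ℕ) < i := by
        ext k
        simp only [Finset.mem_filter, Finset.mem_univ, true_and]
        have := k.2
        omega
      rw [this] at hs
      linarith

/-- The index of the subinterval containing `x`. -/
def index (L : LengthVector n) (x : UnitIco) : Fin n := (L.exists_mem_piece x).choose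

theorem mem_piece_index (L : LengthVector n) (x : UnitIco) : x ∈ L.piece (L.index x) :=
  (L.exists_mem_piece x).choose_spec

theorem leftEnd_add_le (L : LengthVector n) {i j : Fin n} (h : i < j) :
    L.leftEnd i + L.1 i ≤ L.leftEnd j := by
  classical
  unfold leftEnd
  rw [add_comm, ← Finset.sum_insert (s := Finset.univ.filter fun k : Fin n => k < i) (by simp)]
  refine Finset.sum_le_sum_of_subset_of_nonneg ?_ (fun k _ _ => (L.2.1 k).le)
  intro k hk
  simp only [Finset.mem_insert, Finset.mem_filter, Finset.mem_univ, true_and] at hk ⊢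
  rcases hk with rfl | hk
  · exact h
  · exact hk.trans h

theorem index_eq (L : LengthVector n) {x : UnitIco} {j : Fin n} (h : x ∈ L.piece j) :
    L.index x = j := by
  have h' := L.mem_piece_index x
  rcases lt_trichotomy (L.index x) j with hlt | heq | hlt
  · have := L.leftEnd_add_le hlt; have := h.1; have := h'.2; linarith
  · exact heq
  · have := L.leftEnd_add_le hlt; have := h.2; have := h'.1; linarith

theorem iet_mem (L : LengthVector n) (π : Equiv.Perm (Fin n)) {x : UnitIco} {j : Fin n}
    (h : x ∈ L.piece j) :
    (x : ℝ) - L.leftEnd j + ∑ k with π k < π j, L.1 k ∈ Set.Ico (0 : ℝ) 1 := by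
  classical
  have h0 : 0 ≤ ∑ k with π k < π j, L.1 k := Finset.sum_nonneg fun k _ => (L.2.1 k).le
  have h1 : L.1 j + ∑ k with π k < π j, L.1 k ≤ 1 := by
    refine le_of_le_of_eq ?_ L.2.2
    rw [← Finset.sum_insert (s := Finset.univ.filter fun k : Fin n => π k < π j) (by simp)]
    exact Finset.sum_le_sum_of_subset_of_nonneg (Finset.subset_univ _)
      (fun k _ _ => (L.2.1 k).le)
  constructor
  · have := h.1; linarith
  · have := h.2; linarith

/-- The `n`-interval exchange transformation of `[0, 1)` with lengths `L` and permutation `π`: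
`T(x) = x - ∑_{k < j} l_k + ∑_{π(k) < π(j)} l_k` for `x ∈ I_j`; thus `π j` is the position at
which `T` places the `j`-th subinterval. -/
def iet (L : LengthVector n) (π : Equiv.Perm (Fin n)) (x : UnitIco) : UnitIco :=
  ⟨(x : ℝ) - L.leftEnd (L.index x) + ∑ k with π k < π (L.index x), L.1 k,
    L.iet_mem π (L.mem_piece_index x)⟩

theorem iet_apply (L : LengthVector n) (π : Equiv.Perm (Fin n)) {x : UnitIco} {j : Fin n}
    (h : x ∈ L.piece j) :
    (L.iet π x : ℝ) = x - ∑ k with k < j, L.1 k + ∑ k with π k < π j, L.1 k := by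
  simp only [iet, L.index_eq h, leftEnd]

/-- The topology on `[0, 1)` obtained by viewing the interval exchange as a symbolic dynamical
system: the one generated by the sets `{x | T^n x ∈ I_j}`, `n ∈ ℤ`, i.e. the topology pulled back
from the product topology by the (two-sided) itinerary of `x` with respect to the partition
`I_1, …, I_n`. An interval exchange is a bijection, so for `n = -i ≤ 0` the set is `T^i(I_j)`. -/
abbrev symbolicTopology (L : LengthVector n) (π : Equiv.Perm (Fin n)) : TopologicalSpace UnitIco :=
  TopologicalSpace.generateFrom
    {S | ∃ (i : ℕ) (j : Fin n), S = (L.iet π)^[i] ⁻¹' L.piece j ∨ S = (L.iet π)^[i] '' L.piece j}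

end LengthVector

/-- The permutation `(4213)`: the 4th interval is placed first, the 2nd second, the 1st third and
the 3rd last. With indices `0, …, 3`, `invFun` lists the intervals by position, and `toFun` gives
the position of each interval. -/
def perm4213 : Equiv.Perm (Fin 4) where
  toFun := ![2, 1, 3, 0]
  invFun := ![3, 1, 0, 2]
  left_inv := by decide
  right_inv := by decide

/-- Keane's matrices `A_{m,n}`, for `m, n ≥ 1`. -/
def keaneMatrix (m n : ℕ) : Matrix (Fin 4) (Fin 4) ℕ :=
  !![0, 0, 1, 1;
     m - 1, m, 0, 0;
     n, n, n - 1, n;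
     1, 1, 1, 1]

/-- The order in which the subintervals at stage `k` are named: from left to right for even `k`,
from right to left for odd `k`. -/
def namedBefore (k : ℕ) (x y : UnitIco) : Prop := if Even k then x < y else y < x

/-- The (4213) interval exchange `T` with lengths `L` is a Keane interval exchange with parameters
`(m_k, n_k)`, `k ≥ 0`. Put `I^(0) = [0, 1)`, with subintervals `I_j^(0)` those of `T`. For every
`k`, `I^(k+1)` is the 4th subinterval `I_4^(k)` of `I^(k)`, the map induced by `T` on `I^(k)` is an
interval exchange with permutation `(4213)` of subintervals `I_j^(k)` (named from right to left if
`k` is odd), and lengths and itineraries are governed by the matrices `A_{m_k,n_k}`.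
The index `j ∈ {1, 2, 3, 4}` is represented by `j - 1 : Fin 4`. -/
structure KeaneScheme (L : LengthVector 4) (m n : ℕ → ℕ) where
  /-- `I k j` is the subinterval `I_j^(k)`. -/
  I : ℕ → Fin 4 → Set UnitIco
  /-- `len k j` is the length of `I_j^(k)`. -/
  len : ℕ → Fin 4 → ℝ
  /-- `b k j` is the first return time of `I_j^(k)` to `I^(k)`. -/
  b : ℕ → Fin 4 → ℕ
  one_le_m : ∀ k, 1 ≤ m k
  one_le_n : ∀ k, 1 ≤ n k
  I_zero : ∀ j, I 0 j = L.piece j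
  /-- `I^(k+1)` is the 4th subinterval of `I^(k)`. -/
  iUnion_succ : ∀ k, ⋃ j, I (k + 1) j = I k 3
  len_pos : ∀ k j, 0 < len k j
  /-- `I_j^(k)` is a half-open interval of length `len k j`, contained in `[0, 1)`. -/
  isInterval : ∀ k j, ∃ u : ℝ, 0 ≤ u ∧ u + len k j ≤ 1 ∧
    I k j = {x : UnitIco | u ≤ (x : ℝ) ∧ (x : ℝ) < u + len k j}
  /-- The subintervals are named in the prescribed order. -/
  ordered : ∀ k i j, i < j → ∀ x ∈ I k i, ∀ y ∈ I k j, namedBefore k x y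
  /-- All points of `I_j^(k)` have first return time `b k j` to `I^(k)`. -/
  firstReturn : ∀ k j, ∀ x ∈ I k j,
    IsLeast {r : ℕ | 0 < r ∧ (L.iet perm4213)^[r] x ∈ ⋃ i, I k i} (b k j)
  /-- The induced map is a translation on each `I_j^(k)`. -/
  translation : ∀ k j, ∃ c : ℝ, ∀ x ∈ I k j,
    (((L.iet perm4213)^[b k j] x : UnitIco) : ℝ) = x + c
  /-- The induced map places the subintervals in the order `(4213)`. -/
  exchange : ∀ k i j, perm4213 i < perm4213 j → ∀ x ∈ I k i, ∀ y ∈ I k j,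
    namedBefore k ((L.iet perm4213)^[b k i] x) ((L.iet perm4213)^[b k j] y)
  /-- The lengths at stage `k` are `A_{m_k,n_k}` applied to the lengths at stage `k + 1`. -/
  len_eq : ∀ k i, len k i = ∑ j, (keaneMatrix (m k) (n k) i j : ℝ) * len (k + 1) j
  /-- Before its first return to `I^(k+1)`, a point of `I_j^(k+1)` visits `I_i^(k)` as often as the
  `(i, j)` entry of `A_{m_k,n_k}` says. -/
  travel : ∀ k i j, ∀ x ∈ I (k + 1) j,
    Set.ncard {t : ℕ | t < b (k + 1) j ∧ (L.iet perm4213)^[t] x ∈ I k i} =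
      keaneMatrix (m k) (n k) i j

/-- The arithmetic and growth conditions on the parameters `m_k`, `n_k` and the return times
`b_{k,j}` (where `b k j` stands for `b_{k,j+1}`), required at all stages `k ≥ 1`. -/
structure KeaneConditions (m n : ℕ → ℕ) (b : ℕ → Fin 4 → ℕ) : Prop where
  /-- `b_{k,2}` is prime. -/
  prime : ∀ k, 1 ≤ k → (b k 1).Prime
  /-- `b_{i,2}` does not divide `b_{k,3}` for `i < k`. -/
  not_dvd : ∀ i k, 1 ≤ i → i < k → ¬ b i 1 ∣ b k 2
  /-- More than half of the residues modulo `b_{1,2} ⋯ b_{k,2}` are units. -/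
  units : ∀ k, 1 ≤ k →
    (∏ i ∈ Finset.Icc 1 k, b i 1) < 2 * Nat.card (ZMod (∏ i ∈ Finset.Icc 1 k, b i 1))ˣ
  /-- `b_{k,2} b_{k+1,3} + b_{k+1,3} + b_{k,4} + b_{k-1,4} < m_k b_{k,2}`. -/
  growth_m : ∀ k, 1 ≤ k →
    b k 1 * b (k + 1) 2 + b (k + 1) 2 + b k 3 + b (k - 1) 3 < m k * b k 1
  /-- `b_{k,3} b_{k,2} + b_{k,2} < n_k b_{k,3}`. -/
  growth_n : ∀ k, 1 ≤ k → b k 2 * b k 1 + b k 1 < n k * b k 2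

end

/-! Inducing on the last interval reproduces the permutation (4213) with the orientation reversed
(`InducedExchange.next`). Hence the parameters can be prescribed in advance, and a compactness
argument supplies positive lengths that realise them at all stages (`exists_keane_lengths`).

Mixing is then a question about return times. Let a_k and c_k be those of the second and third piece
of stage k. A point of the second piece of stage k+1 makes m_k consecutive visits to the second
piece of stage k and then n_k to the third. Starting and stopping inside this run gives returns to
I^(k) after p a_k + q c_k steps, p ≤ m_k, q ≤ n_k. As a_k and c_k are coprime and a_k ≤ n_k, these
times fill [a_k c_k, m_k a_k]. Running on into the next stage gives the times p a_k + n_k c_k + q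
c_{k+1}, and since a_k and c_{k+1} are coprime these lead from m_k a_k to a_{k+1} c_{k+1}, where
stage k+1 takes over. So for K ≥ 1 every large time is a return time of some point of I^(K)
(`KeaneSystem.eventually_return`). Every nonempty open set receives all of some I^(K) at one fixed
time (`KeaneSystem.exists_iterate_mem_open`), and mixing follows.

The coprimality is arranged inductively (`Admissible.exists_next`): a pigeonhole among units fixes
n_k modulo the earlier a_i, and Dirichlet's theorem on primes in progressions then gives m_k.

For the symbolic topology, open sets contain an interval to the right of each of their points, hence
have standard interior when nonempty, so standard mixing suffices. -/

open Filter Topology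

noncomputable section

/-! ### Half-open intervals read in either direction -/

/-- The half-open interval `[a, b)` that, in the coordinate with origin `u` and direction `σ = ±1`,
starts at `s` and has width `w`. -/
def orientedIco (u σ s w : ℝ) : Set ℝ :=
  {x | -(w / 2) ≤ x - (u + σ * (s + w / 2)) ∧ x - (u + σ * (s + w / 2)) < w / 2}

namespace orientedIco

variable {u σ s w s' w' x y : ℝ}

theorem mono (hσ : σ = 1 ∨ σ = -1) (h₁ : s' ≤ s) (h₂ : s + w ≤ s' + w')
    (hx : x ∈ orientedIco u σ s w) : x ∈ orientedIco u σ s' w' := by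
  simp only [orientedIco, Set.mem_ofPred_eq] at *
  rcases hσ with rfl | rfl <;> constructor <;> linarith

theorem add_mul_mem_iff {d : ℝ} :
    x + σ * d ∈ orientedIco u σ (s + d) w ↔ x ∈ orientedIco u σ s w := by
  simp only [orientedIco, Set.mem_ofPred_eq]
  ring_nf

/-- Both sides have the same midpoint, and the direction enters `orientedIco` only through the
midpoint. The closed end is always the left one, so reversing the naming order loses no endpoint. -/
theorem reverse (t : ℝ) : orientedIco (u + σ * t) (-σ) s w = orientedIco u σ (t - s - w) w := by
  ext x
  simp only [orientedIco, Set.mem_ofPred_eq]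
  ring_nf

theorem lt_of_le (h : s + w ≤ s') (hx : x ∈ orientedIco u 1 s w)
    (hy : y ∈ orientedIco u 1 s' w') : x < y := by
  simp only [orientedIco, Set.mem_ofPred_eq] at *
  linarith

theorem lt_of_le_neg (h : s + w ≤ s') (hx : x ∈ orientedIco u (-1) s w)
    (hy : y ∈ orientedIco u (-1) s' w') : y < x := by
  simp only [orientedIco, Set.mem_ofPred_eq] at *
  linarith

theorem ne_of_le (hσ : σ = 1 ∨ σ = -1) (h : s + w ≤ s') (hx : x ∈ orientedIco u σ s w)
    (hy : y ∈ orientedIco u σ s' w') : x ≠ y := by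
  rcases hσ with rfl | rfl
  · exact (lt_of_le h hx hy).ne
  · exact (lt_of_le_neg h hx hy).ne'

theorem abs_sub_lt (hx : x ∈ orientedIco u σ s w) (hy : y ∈ orientedIco u σ s w) :
    |x - y| < w := by
  simp only [orientedIco, Set.mem_ofPred_eq] at *
  rw [abs_lt]
  constructor <;> linarith

theorem split_two (hσ : σ = 1 ∨ σ = -1) {a b : ℝ} (h : x ∈ orientedIco u σ s (a + b)) :
    x ∈ orientedIco u σ s a ∨ x ∈ orientedIco u σ (s + a) b := by
  simp only [orientedIco, Set.mem_ofPred_eq] at *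
  rcases hσ with rfl | rfl
  · rcases lt_or_ge x (u + s + a) with h' | h'
    · left; constructor <;> linarith
    · right; constructor <;> linarith
  · rcases lt_or_ge x (u - s - a) with h' | h'
    · right; constructor <;> linarith
    · left; constructor <;> linarith

theorem split_four (hσ : σ = 1 ∨ σ = -1) {a b c d : ℝ}
    (h : x ∈ orientedIco u σ 0 (a + b + c + d)) :
    x ∈ orientedIco u σ 0 a ∨ x ∈ orientedIco u σ a b ∨ x ∈ orientedIco u σ (a + b) c ∨
      x ∈ orientedIco u σ (a + b + c) d := by
  rcases split_two hσ h with h | h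
  · rcases split_two hσ h with h | h
    · rcases split_two hσ h with h | h
      · exact Or.inl h
      · rw [zero_add] at h; exact Or.inr (Or.inl h)
    · rw [zero_add] at h; exact Or.inr (Or.inr (Or.inl h))
  · rw [zero_add] at h; exact Or.inr (Or.inr (Or.inr h))

end orientedIco

/-! ### Itineraries as words -/

/-- `Follows T I b w x`: the orbit of `x` visits the sets `I i` in the order given by the word `w`,
where each visit to `I i` is followed by `b i` steps of `T`. -/
def Follows {X ι : Type*} (T : X → X) (I : ι → Set X) (b : ι → ℕ) : List ι → X → Prop
  | [], _ => True
  | i :: w, x => x ∈ I i ∧ Follows T I b w (T^[b i] x)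

/-- The number of steps of `T` taken along the word `w`. -/
def wordTime {ι : Type*} (b : ι → ℕ) (w : List ι) : ℕ := (w.map b).sum

section Follows

variable {X ι : Type*} {T : X → X} {I : ι → Set X} {b : ι → ℕ}

@[simp] theorem wordTime_nil : wordTime b [] = 0 := rfl

@[simp] theorem wordTime_cons (i : ι) (w : List ι) :
    wordTime b (i :: w) = b i + wordTime b w := by simp [wordTime]

@[simp] theorem wordTime_append (w w' : List ι) :
    wordTime b (w ++ w') = wordTime b w + wordTime b w' := by simp [wordTime]

@[simp] theorem wordTime_replicate (n : ℕ) (i : ι) :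
    wordTime b (List.replicate n i) = n * b i := by simp [wordTime]

theorem follows_append {w w' : List ι} {x : X} :
    Follows T I b (w ++ w') x ↔ Follows T I b w x ∧ Follows T I b w' (T^[wordTime b w] x) := by
  induction w generalizing x with
  | nil => simp [Follows]
  | cons i w ih =>
    simp only [List.cons_append, Follows, ih, wordTime_cons, and_assoc]
    rw [add_comm (b i), Function.iterate_add_apply]

theorem follows_singleton {i : ι} {x : X} : Follows T I b [i] x ↔ x ∈ I i := by simp [Follows]

/-- Each letter `i` of the word accounts for `b i` steps, and only the first of them can lie in a
piece, namely in `I i`. -/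
theorem Follows.count_eq [DecidableEq ι] {w : List ι} {x : X} (j : ι)
    [∀ y, DecidablePred fun t => T^[t] y ∈ I j] (hb : ∀ i, 0 < b i)
    (h : ∀ i, ∀ x ∈ I i, ∀ t < b i, T^[t] x ∈ I j ↔ t = 0 ∧ i = j) (hw : Follows T I b w x) :
    Nat.count (fun t => T^[t] x ∈ I j) (wordTime b w) = w.count j := by
  classical
  induction w generalizing x with
  | nil => simp
  | cons i w ih =>
    rw [wordTime_cons, Nat.count_add, List.count_cons, add_comm]
    congr 1
    · rw [← ih hw.2]
      simp only [Nat.count_eq_card_filter_range]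
      congr 1
      ext t
      simp only [Finset.mem_filter, ← Function.iterate_add_apply,
        add_comm (b i)]
    · rw [Nat.count_eq_card_filter_range]
      by_cases hij : i = j
      · simp only [hij, beq_self_eq_true, if_true]
        rw [Finset.card_eq_one]
        refine ⟨0, ?_⟩
        ext t
        simp only [Finset.mem_filter, Finset.mem_range, Finset.mem_singleton]
        constructor
        · rintro ⟨h1, h2⟩
          exact ((h i x hw.1 t (hij ▸ h1)).1 h2).1
        · rintro rfl
          exact ⟨hb j, (h i x hw.1 0 (hb i)).2 ⟨rfl, hij⟩⟩
      · have : (i == j) = false := by simpa using hij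
        simp only [this, Bool.false_eq_true, if_false]
        rw [Finset.card_eq_zero, Finset.filter_eq_empty_iff]
        intro t ht h2
        exact hij ((h i x hw.1 t (Finset.mem_range.1 ht)).1 h2).2

theorem Follows.eq_of_append_singleton {w : List ι} {x : X} {i j : ι}
    (hI : ∀ i j x, x ∈ I i → x ∈ I j → i = j) (hi : Follows T I b (w ++ [i]) x)
    (hj : Follows T I b (w ++ [j]) x) : i = j := by
  rw [follows_append, follows_singleton] at hi hj
  exact hI _ _ _ hi.2 hj.2

theorem isOpen_follows [TopologicalSpace X] (hT : Continuous T) (hI : ∀ i, IsOpen (I i))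
    (w : List ι) : IsOpen {x | Follows T I b w x} := by
  induction w with
  | nil => simp [Follows]
  | cons i w ih => exact (hI i).inter (ih.preimage (hT.iterate (b i)))

end Follows

theorem Follows.iterate_sub_iterate {ι : Type*} {T : UnitIco → UnitIco} {I : ι → Set UnitIco}
    {b : ι → ℕ} (h : ∀ i, ∀ x ∈ I i, ∀ y ∈ I i, ∀ t ≤ b i, (T^[t] x : ℝ) - T^[t] y = x - y)
    {w : List ι} {x y : UnitIco} (hx : Follows T I b w x) (hy : Follows T I b w y) {t : ℕ}
    (ht : t ≤ wordTime b w) : (T^[t] x : ℝ) - T^[t] y = x - y := by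
  induction w generalizing x y t with
  | nil =>
    simp at ht
    simp [ht]
  | cons i w ih =>
    rcases le_total t (b i) with hti | hti
    · exact h i x hx.1 y hy.1 t hti
    · obtain ⟨r, rfl⟩ := Nat.exists_eq_add_of_le hti
      rw [add_comm, Function.iterate_add_apply, Function.iterate_add_apply,
        ih hx.2 hy.2 (by simp at ht; omega)]
      exact h i x hx.1 y hy.1 _ le_rfl

/-! ### Exchanges induced on an interval -/

/-- Offsets of the four intervals of lengths `l`. -/
def domStart (l : Fin 4 → ℝ) : Fin 4 → ℝ := ![0, l 0, l 0 + l 1, l 0 + l 1 + l 2]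

/-- Offsets of the images of the four intervals under the exchange `(4213)`. -/
def imgStart (l : Fin 4 → ℝ) : Fin 4 → ℝ := ![l 3 + l 1, l 3, l 3 + l 1 + l 0, 0]

/-- Total length. -/
def totalLength (l : Fin 4 → ℝ) : ℝ := l 0 + l 1 + l 2 + l 3

/-- The `j`-th of the consecutive intervals of lengths `l` starting at `u` in direction `σ`. -/
def subPiece (u σ : ℝ) (l : Fin 4 → ℝ) (j : Fin 4) : Set UnitIco :=
  {x | (x : ℝ) ∈ orientedIco u σ (domStart l j) (l j)}

/-- The union of the consecutive intervals of lengths `l` starting at `u` in direction `σ`. -/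
def baseInterval (u σ : ℝ) (l : Fin 4 → ℝ) : Set UnitIco :=
  {x | (x : ℝ) ∈ orientedIco u σ 0 (totalLength l)}

/-- The map induced by `T` on `baseInterval u σ l` is an exchange of the intervals
`subPiece u σ l j` with permutation `(4213)` and return times `b j`. -/
structure InducedExchange (T : UnitIco → UnitIco) (u σ : ℝ) (l : Fin 4 → ℝ) (b : Fin 4 → ℕ) :
    Prop where
  sign : σ = 1 ∨ σ = -1
  pos : ∀ j, 0 < l j
  inside : orientedIco u σ 0 (totalLength l) ⊆ Set.Ico 0 1
  time_pos : ∀ j, 0 < b j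
  shift : ∀ j, ∀ x ∈ subPiece u σ l j, (T^[b j] x : ℝ) = x + σ * (imgStart l j - domStart l j)
  no_return : ∀ j, ∀ x ∈ subPiece u σ l j, ∀ t, 0 < t → t < b j → T^[t] x ∉ baseInterval u σ l
  rigid : ∀ j, ∀ x ∈ subPiece u σ l j, ∀ y ∈ subPiece u σ l j, ∀ t ≤ b j,
    (T^[t] x : ℝ) - T^[t] y = x - y

/-- The itinerary, through the old pieces, of the `j`-th piece of the next stage. -/
def keaneWord (m n : ℕ) : Fin 4 → List (Fin 4) :=
  ![3 :: (List.replicate (m - 1) 1 ++ List.replicate n 2),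
    3 :: (List.replicate m 1 ++ List.replicate n 2),
    3 :: 0 :: List.replicate (n - 1) 2,
    3 :: 0 :: List.replicate n 2]

theorem count_keaneWord (m n : ℕ) (i j : Fin 4) :
    (keaneWord m n j).count i = keaneMatrix m n i j := by
  fin_cases i <;> fin_cases j <;>
    simp [keaneWord, keaneMatrix, List.count_replicate]

/-- The return times of the next stage. -/
def nextTime (m n : ℕ) (b : Fin 4 → ℕ) (j : Fin 4) : ℕ := ∑ i, keaneMatrix m n i j * b i

theorem wordTime_keaneWord (m n : ℕ) (b : Fin 4 → ℕ) (j : Fin 4) :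
    wordTime b (keaneWord m n j) = nextTime m n b j := by
  fin_cases j <;> simp [nextTime, Fin.sum_univ_four, keaneWord, keaneMatrix] <;> ring

/-- An interval at offset `s` of width `v` fits into the pieces prescribed by the word while it is
moved by the exchange with lengths `l`. -/
def Fits (l : Fin 4 → ℝ) (v : ℝ) : List (Fin 4) → ℝ → Prop
  | [], _ => True
  | i :: w, s => domStart l i ≤ s ∧ s + v ≤ domStart l i + l i ∧
      Fits l v w (s + (imgStart l i - domStart l i))

/-- The displacement along a word. -/
def wordShift (l : Fin 4 → ℝ) (w : List (Fin 4)) : ℝ :=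
  (w.map fun i => imgStart l i - domStart l i).sum

section Fits

variable {l : Fin 4 → ℝ} {v : ℝ}

@[simp] theorem wordShift_nil : wordShift l [] = 0 := rfl

@[simp] theorem wordShift_cons (i : Fin 4) (w : List (Fin 4)) :
    wordShift l (i :: w) = imgStart l i - domStart l i + wordShift l w := by simp [wordShift]

@[simp] theorem wordShift_append (w w' : List (Fin 4)) :
    wordShift l (w ++ w') = wordShift l w + wordShift l w' := by simp [wordShift]

@[simp] theorem wordShift_replicate (n : ℕ) (i : Fin 4) :
    wordShift l (List.replicate n i) = n * (imgStart l i - domStart l i) := by simp [wordShift]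

theorem fits_append {w w' : List (Fin 4)} {s : ℝ} :
    Fits l v (w ++ w') s ↔ Fits l v w s ∧ Fits l v w' (s + wordShift l w) := by
  induction w generalizing s with
  | nil => simp [Fits]
  | cons i w ih => simp [Fits, ih, and_assoc, add_assoc]

/-- The displacement is nonnegative, so the first visit controls one end and the last visit the
other. The extra displacement on the right of `h₂` avoids writing `n - 1`. -/
theorem fits_replicate {i : Fin 4} (n : ℕ) {s : ℝ} (h : 0 ≤ imgStart l i - domStart l i)
    (h₁ : domStart l i ≤ s)
    (h₂ : s + n * (imgStart l i - domStart l i) + v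
      ≤ domStart l i + l i + (imgStart l i - domStart l i)) :
    Fits l v (List.replicate n i) s := by
  induction n generalizing s with
  | zero => simp [Fits]
  | succ n ih =>
    push_cast at h₂
    have := mul_nonneg n.cast_nonneg h
    refine ⟨h₁, by linarith, ih (by linarith) (by linarith)⟩

end Fits

namespace InducedExchange

variable {T : UnitIco → UnitIco} {u σ : ℝ} {l l' : Fin 4 → ℝ} {b : Fin 4 → ℕ} {m n : ℕ}

/-- This reduces the dynamics to linear inequalities between lengths: an interval that fits is
translated as a whole along the word. -/
theorem follows_of_fits (H : InducedExchange T u σ l b) {w : List (Fin 4)} {s v : ℝ}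
    {x : UnitIco} (hx : (x : ℝ) ∈ orientedIco u σ s v) (hw : Fits l v w s) :
    Follows T (subPiece u σ l) b w x ∧
      (T^[wordTime b w] x : ℝ) = x + σ * wordShift l w := by
  induction w generalizing s x with
  | nil => simp [Follows]
  | cons i w ih =>
    have hxi : x ∈ subPiece u σ l i := orientedIco.mono H.sign hw.1 hw.2.1 hx
    have hs := H.shift i x hxi
    have := ih (x := T^[b i] x) (by rw [hs]; exact orientedIco.add_mul_mem_iff.2 hx) hw.2.2
    refine ⟨⟨hxi, this.1⟩, ?_⟩
    rw [wordTime_cons, add_comm, Function.iterate_add_apply, this.2, hs, wordShift_cons]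
    ring

theorem subPiece_subset (H : InducedExchange T u σ l b) (j : Fin 4) :
    subPiece u σ l j ⊆ baseInterval u σ l := by
  intro x hx
  have h0 := H.pos 0
  have h1 := H.pos 1
  have h2 := H.pos 2
  have h3 := H.pos 3
  refine orientedIco.mono H.sign ?_ ?_ hx <;> fin_cases j <;>
    simp [domStart, totalLength] <;> linarith

theorem iUnion_subPiece (H : InducedExchange T u σ l b) :
    ⋃ j, subPiece u σ l j = baseInterval u σ l := by
  refine subset_antisymm (Set.iUnion_subset H.subPiece_subset) fun x hx => ?_
  rw [Set.mem_iUnion]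
  rcases orientedIco.split_four H.sign hx with h | h | h | h
  · exact ⟨0, h⟩
  · exact ⟨1, h⟩
  · exact ⟨2, h⟩
  · exact ⟨3, h⟩

theorem domStart_add_le (H : InducedExchange T u σ l b) {i j : Fin 4} (h : i < j) :
    domStart l i + l i ≤ domStart l j := by
  have h0 := H.pos 0
  have h1 := H.pos 1
  have h2 := H.pos 2
  have h3 := H.pos 3
  revert h
  fin_cases i <;> fin_cases j <;> simp [domStart] <;> linarith

theorem imgStart_add_le (H : InducedExchange T u σ l b) {i j : Fin 4}
    (h : perm4213 i < perm4213 j) : imgStart l i + l i ≤ imgStart l j := by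
  have h0 := H.pos 0
  have h1 := H.pos 1
  have h2 := H.pos 2
  have h3 := H.pos 3
  revert h
  fin_cases i <;> fin_cases j <;> simp [perm4213, imgStart] <;> linarith

theorem subPiece_unique (H : InducedExchange T u σ l b) (i j : Fin 4) (x : UnitIco)
    (hi : x ∈ subPiece u σ l i) (hj : x ∈ subPiece u σ l j) : i = j := by
  rcases lt_trichotomy i j with h | h | h
  · exact absurd rfl (orientedIco.ne_of_le H.sign (H.domStart_add_le h) hi hj)
  · exact h
  · exact absurd rfl (orientedIco.ne_of_le H.sign (H.domStart_add_le h) hj hi)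

theorem iterate_mem_image (H : InducedExchange T u σ l b) {j : Fin 4} {x : UnitIco}
    (hx : x ∈ subPiece u σ l j) : (T^[b j] x : ℝ) ∈ orientedIco u σ (imgStart l j) (l j) := by
  rw [H.shift j x hx]
  have := (orientedIco.add_mul_mem_iff (d := imgStart l j - domStart l j)).2 hx
  rwa [add_sub_cancel] at this

theorem iterate_mem_base (H : InducedExchange T u σ l b) {j : Fin 4} {x : UnitIco}
    (hx : x ∈ subPiece u σ l j) : T^[b j] x ∈ baseInterval u σ l := by
  have h0 := H.pos 0
  have h1 := H.pos 1
  have h2 := H.pos 2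
  have h3 := H.pos 3
  refine orientedIco.mono H.sign ?_ ?_ (H.iterate_mem_image hx) <;> fin_cases j <;>
    simp [imgStart, totalLength] <;> linarith

theorem mem_subPiece_iff (H : InducedExchange T u σ l b) {i j : Fin 4} {x : UnitIco}
    (hx : x ∈ subPiece u σ l i) {t : ℕ} (ht : t < b i) :
    T^[t] x ∈ subPiece u σ l j ↔ t = 0 ∧ i = j := by
  constructor
  · intro h
    rcases Nat.eq_zero_or_pos t with rfl | h0
    · exact ⟨rfl, H.subPiece_unique _ _ _ hx h⟩
    · exact absurd (H.subPiece_subset j h) (H.no_return i x hx t h0 ht)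
  · rintro ⟨rfl, rfl⟩
    exact hx

theorem exists_subPiece_of_image (H : InducedExchange T u σ l b) {j : Fin 4} {y : UnitIco}
    (hy : (y : ℝ) ∈ orientedIco u σ (imgStart l j) (l j)) :
    ∃ x ∈ subPiece u σ l j, T^[b j] x = y ∧
      (y : ℝ) = x + σ * (imgStart l j - domStart l j) := by
  have h0 := H.pos 0
  have h1 := H.pos 1
  have h2 := H.pos 2
  have h3 := H.pos 3
  have hx : (y : ℝ) + σ * (domStart l j - imgStart l j) ∈ orientedIco u σ (domStart l j) (l j) := by
    have := (orientedIco.add_mul_mem_iff (d := domStart l j - imgStart l j)).2 hy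
    rwa [add_sub_cancel] at this
  have hx' := H.inside (orientedIco.mono (s' := 0) (w' := totalLength l) H.sign
    (by fin_cases j <;> simp [domStart] <;> linarith)
    (by fin_cases j <;> simp [domStart, totalLength] <;> linarith) hx)
  refine ⟨⟨_, hx'⟩, hx, ?_, ?_⟩
  · refine Subtype.ext ?_
    rw [H.shift j ⟨_, hx'⟩ hx]
    simp only
    ring
  · simp only
    ring

/-- Every point of the base has a preimage in the last piece. -/
theorem exists_iterate_last (H : InducedExchange T u σ l b) (hl : l 0 < l 3) {y : UnitIco}
    (hy : y ∈ baseInterval u σ l) : ∃ x ∈ subPiece u σ l 3, ∃ t, T^[t] x = y := by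
  have h0 := H.pos 0
  have h1 := H.pos 1
  have h2 := H.pos 2
  have h3 := H.pos 3
  -- The image of the last piece is placed first. Any other point of the base is pulled back by at
  -- least `l 3 - l 0` towards the origin, so the last piece's image is reached after finitely many
  -- backward steps.
  have key : ∀ N : ℕ, ∀ y ∈ baseInterval u σ l, σ * (y - u) < N * (l 3 - l 0) →
      ∃ x ∈ subPiece u σ l 3, ∃ t, T^[t] x = y := by
    intro N
    induction N with
    | zero =>
      intro y hy hN
      exfalso
      simp only [baseInterval, orientedIco, Set.mem_ofPred_eq] at hy
      rcases H.sign with h | h <;> subst h <;> simp at hN <;> linarith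
    | succ N ih =>
      intro y hy hN
      push_cast at hN
      have hsq : σ * σ = 1 := by rcases H.sign with h | h <;> subst h <;> norm_num
      have back : ∀ j, l 3 - l 0 ≤ imgStart l j - domStart l j →
          (y : ℝ) ∈ orientedIco u σ (imgStart l j) (l j) →
          ∃ x ∈ subPiece u σ l 3, ∃ t, T^[t] x = y := by
        intro j hj hyj
        obtain ⟨z, hz, hzy, hzr⟩ := H.exists_subPiece_of_image hyj
        obtain ⟨x, hx, t, ht⟩ := ih z (H.subPiece_subset j hz) (by
          rw [hzr] at hN
          have : σ * (z + σ * (imgStart l j - domStart l j) - u)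
            = σ * (z - u) + σ * σ * (imgStart l j - domStart l j) := by ring
          rw [this, hsq] at hN
          linarith)
        exact ⟨x, hx, b j + t, by rw [Function.iterate_add_apply, ht, hzy]⟩
      have hy' : (y : ℝ) ∈ orientedIco u σ 0 (l 3 + l 1 + l 0 + l 2) := by
        have : totalLength l = l 3 + l 1 + l 0 + l 2 := by simp only [totalLength]; ring
        rw [← this]; exact hy
      rcases orientedIco.split_four H.sign hy' with h | h | h | h
      · obtain ⟨z, hz, hzy, -⟩ := H.exists_subPiece_of_image (j := 3) h
        exact ⟨z, hz, _, hzy⟩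
      · exact back 1 (by simp [imgStart, domStart]) h
      · exact back 0 (by simp [imgStart, domStart]; linarith) h
      · exact back 2 (by simp [imgStart, domStart]; linarith) h
  obtain ⟨N, hN⟩ := exists_nat_gt (σ * (y - u) / (l 3 - l 0))
  exact key N y hy ((div_lt_iff₀ (by linarith)).1 hN)

end InducedExchange

/-! ### Passing to the next stage -/

namespace InducedExchange

variable {T : UnitIco → UnitIco} {u σ : ℝ} {l l' : Fin 4 → ℝ} {b : Fin 4 → ℕ} {m n : ℕ}

/-- The old piece 3, moved to the front, puts the new pieces 2 and 3 onto the old piece 0 and the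
new 0 and 1 into the old piece 1. They then drift by `l 3 - l 0` per visit in the old piece 1 and by
`l 3` in the old piece 2, until they are back in piece 3. The starting offset and the minus sign
come from the reversal of direction. -/
theorem fits_keaneWord (hm : 1 ≤ m) (hn : 1 ≤ n) (hpos : ∀ j, 0 < l' j)
    (hl : ∀ i, l i = ∑ j, (keaneMatrix m n i j : ℝ) * l' j) (j : Fin 4) :
    Fits l (l' j) (keaneWord m n j) (totalLength l - domStart l' j - l' j) ∧
      wordShift l (keaneWord m n j) = -(imgStart l' j - domStart l' j) := by
  obtain ⟨m, rfl⟩ := Nat.exists_eq_add_of_le' hm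
  obtain ⟨n, rfl⟩ := Nat.exists_eq_add_of_le' hn
  have p0 := hpos 0
  have p1 := hpos 1
  have p2 := hpos 2
  have p3 := hpos 3
  have h0 : l 0 = l' 2 + l' 3 := by
    rw [hl]; simp [Fin.sum_univ_four, keaneMatrix]
  have h1 : l 1 = m * l' 0 + (m + 1) * l' 1 := by
    rw [hl]; simp [Fin.sum_univ_four, keaneMatrix]
  have h2 : l 2 = (n + 1) * l' 0 + (n + 1) * l' 1 + n * l' 2 + (n + 1) * l' 3 := by
    rw [hl]; simp [Fin.sum_univ_four, keaneMatrix]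
  have h3 : l 3 = l' 0 + l' 1 + l' 2 + l' 3 := by
    rw [hl]; simp [Fin.sum_univ_four, keaneMatrix]
  have m0 := mul_nonneg m.cast_nonneg p0.le
  have m1 := mul_nonneg m.cast_nonneg p1.le
  have n0 := mul_nonneg n.cast_nonneg p0.le
  have n1 := mul_nonneg n.cast_nonneg p1.le
  have n2 := mul_nonneg n.cast_nonneg p2.le
  have n3 := mul_nonneg n.cast_nonneg p3.le
  have d1 : 0 ≤ imgStart l 1 - domStart l 1 := by
    simp [imgStart, domStart]; linarith
  have d2 : 0 ≤ imgStart l 2 - domStart l 2 := by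
    simp [imgStart, domStart]; linarith
  fin_cases j
  · refine ⟨⟨?_, ?_, fits_append.2 ⟨fits_replicate _ d1 ?_ ?_, fits_replicate _ d2 ?_ ?_⟩⟩, ?_⟩ <;>
      simp [imgStart, domStart, totalLength, keaneWord, h0, h1, h2, h3] <;> linarith
  · refine ⟨⟨?_, ?_, fits_append.2 ⟨fits_replicate _ d1 ?_ ?_, fits_replicate _ d2 ?_ ?_⟩⟩, ?_⟩ <;>
      simp [imgStart, domStart, totalLength, keaneWord, h0, h1, h2, h3] <;> linarith
  · refine ⟨⟨?_, ?_, ?_, ?_, fits_replicate _ d2 ?_ ?_⟩, ?_⟩ <;>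
      simp [imgStart, domStart, totalLength, keaneWord, h0, h1, h2, h3] <;> linarith
  · refine ⟨⟨?_, ?_, ?_, ?_, fits_replicate _ d2 ?_ ?_⟩, ?_⟩ <;>
      simp [imgStart, domStart, totalLength, keaneWord, h0, h1, h2, h3] <;> linarith

theorem mem_subPiece_reverse {j : Fin 4} {x : UnitIco} :
    x ∈ subPiece (u + σ * totalLength l) (-σ) l' j ↔
      (x : ℝ) ∈ orientedIco u σ (totalLength l - domStart l' j - l' j) (l' j) := by
  rw [← orientedIco.reverse]
  rfl

theorem totalLength_eq_last (hl : ∀ i, l i = ∑ j, (keaneMatrix m n i j : ℝ) * l' j) :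
    l 3 = totalLength l' := by
  rw [hl]; simp [Fin.sum_univ_four, keaneMatrix, totalLength]

theorem baseInterval_reverse (hl : ∀ i, l i = ∑ j, (keaneMatrix m n i j : ℝ) * l' j) :
    baseInterval (u + σ * totalLength l) (-σ) l' = subPiece u σ l 3 := by
  have : domStart l 3 = totalLength l - 0 - totalLength l' := by
    rw [← totalLength_eq_last hl]
    simp [domStart, totalLength]
  rw [baseInterval, subPiece, orientedIco.reverse, this, totalLength_eq_last hl]

theorem follows_keaneWord (H : InducedExchange T u σ l b) (hm : 1 ≤ m) (hn : 1 ≤ n)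
    (hpos : ∀ j, 0 < l' j) (hl : ∀ i, l i = ∑ j, (keaneMatrix m n i j : ℝ) * l' j)
    {j : Fin 4} {x : UnitIco} (hx : x ∈ subPiece (u + σ * totalLength l) (-σ) l' j) :
    Follows T (subPiece u σ l) b (keaneWord m n j) x :=
  (H.follows_of_fits (mem_subPiece_reverse.1 hx) (fits_keaneWord hm hn hpos hl j).1).1

open Classical in
theorem count_visits (H : InducedExchange T u σ l b) {w : List (Fin 4)} {x : UnitIco}
    (hw : Follows T (subPiece u σ l) b w x) (i : Fin 4) :
    Nat.count (fun t => T^[t] x ∈ subPiece u σ l i) (wordTime b w) = w.count i :=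
  hw.count_eq i H.time_pos fun _ _ hx _ ht => H.mem_subPiece_iff hx ht

open Classical in
theorem count_keane (H : InducedExchange T u σ l b) (hm : 1 ≤ m) (hn : 1 ≤ n)
    (hpos : ∀ j, 0 < l' j) (hl : ∀ i, l i = ∑ j, (keaneMatrix m n i j : ℝ) * l' j)
    {j : Fin 4} {x : UnitIco} (hx : x ∈ subPiece (u + σ * totalLength l) (-σ) l' j) (i : Fin 4) :
    Nat.count (fun t => T^[t] x ∈ subPiece u σ l i) (nextTime m n b j) = keaneMatrix m n i j := by
  rw [← wordTime_keaneWord, H.count_visits (H.follows_keaneWord hm hn hpos hl hx),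
    count_keaneWord]

theorem next (H : InducedExchange T u σ l b) (hm : 1 ≤ m) (hn : 1 ≤ n)
    (hpos : ∀ j, 0 < l' j) (hl : ∀ i, l i = ∑ j, (keaneMatrix m n i j : ℝ) * l' j) :
    InducedExchange T (u + σ * totalLength l) (-σ) l' (nextTime m n b) where
  sign := by rcases H.sign with h | h <;> simp [h]
  pos := hpos
  inside := by
    rw [orientedIco.reverse, ← totalLength_eq_last hl]
    refine fun x hx => H.inside (orientedIco.mono H.sign ?_ ?_ hx)
    · have h0 := H.pos 0
      have h1 := H.pos 1
      have h2 := H.pos 2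
      simp only [totalLength]
      linarith
    · linarith
  time_pos j := by
    have h3 := H.time_pos 3
    have : keaneMatrix m n 3 j = 1 := by fin_cases j <;> rfl
    refine h3.trans_le ?_
    calc b 3 = keaneMatrix m n 3 j * b 3 := by rw [this, one_mul]
      _ ≤ _ := Finset.single_le_sum (f := fun i => keaneMatrix m n i j * b i)
          (fun _ _ => Nat.zero_le _) (Finset.mem_univ _)
  shift j x hx := by
    have h := fits_keaneWord hm hn hpos hl j
    rw [← wordTime_keaneWord, (H.follows_of_fits (mem_subPiece_reverse.1 hx) h.1).2, h.2]
    ring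
  no_return j x hx t ht htb := by
    classical
    rw [baseInterval_reverse hl]
    intro hmem
    -- The new base is the old piece 3, visited exactly once before the return time. Time 0 is that
    -- visit.
    have hc := H.count_keane hm hn hpos hl hx 3
    have h1 : keaneMatrix m n 3 j = 1 := by fin_cases j <;> rfl
    rw [h1, Nat.count_eq_card_filter_range, Finset.card_eq_one] at hc
    obtain ⟨a, ha⟩ := hc
    have hx3 : x ∈ subPiece u σ l 3 := by
      have := H.follows_keaneWord hm hn hpos hl hx
      fin_cases j <;> exact this.1
    have e0 : 0 ∈ ({a} : Finset ℕ) := by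
      rw [← ha, Finset.mem_filter, Finset.mem_range]
      exact ⟨by omega, hx3⟩
    have e1 : t ∈ ({a} : Finset ℕ) := by
      rw [← ha, Finset.mem_filter, Finset.mem_range]
      exact ⟨htb, hmem⟩
    rw [Finset.mem_singleton] at e0 e1
    omega
  rigid j x hx y hy t ht := by
    refine Follows.iterate_sub_iterate H.rigid (H.follows_keaneWord hm hn hpos hl hx)
      (H.follows_keaneWord hm hn hpos hl hy) ?_
    rwa [wordTime_keaneWord]

/-- An itinerary distinguishing the `j`-th piece of the next stage from the other ones. -/
def keaneCode (m n : ℕ) : Fin 4 → List (Fin 4) :=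
  ![3 :: List.replicate (m - 1) 1 ++ [2], 3 :: List.replicate (m - 1) 1 ++ [1],
    3 :: 0 :: List.replicate (n - 1) 2 ++ [3], 3 :: 0 :: List.replicate (n - 1) 2 ++ [2]]

theorem follows_keaneCode (H : InducedExchange T u σ l b) (hm : 1 ≤ m) (hn : 1 ≤ n)
    (hpos : ∀ j, 0 < l' j) (hl : ∀ i, l i = ∑ j, (keaneMatrix m n i j : ℝ) * l' j)
    {j : Fin 4} {x : UnitIco} (hx : x ∈ subPiece (u + σ * totalLength l) (-σ) l' j) :
    Follows T (subPiece u σ l) b (keaneCode m n j) x := by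
  have h := H.follows_keaneWord hm hn hpos hl hx
  have h' := (H.next hm hn hpos hl).iterate_mem_base hx
  rw [baseInterval_reverse hl, ← wordTime_keaneWord] at h'
  obtain ⟨m, rfl⟩ := Nat.exists_eq_add_of_le' hm
  obtain ⟨n, rfl⟩ := Nat.exists_eq_add_of_le' hn
  fin_cases j
  · have e : keaneWord (m + 1) (n + 1) 0
        = (3 :: List.replicate m 1 ++ [2]) ++ List.replicate n 2 := by
      simp [keaneWord, List.replicate_succ]
    change Follows _ _ _ (keaneWord (m + 1) (n + 1) 0) x at h
    rw [e, follows_append] at h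
    exact h.1
  · have e : keaneWord (m + 1) (n + 1) 1
        = (3 :: List.replicate m 1 ++ [1]) ++ List.replicate (n + 1) 2 := by
      simp [keaneWord, List.replicate_succ']
    change Follows _ _ _ (keaneWord (m + 1) (n + 1) 1) x at h
    rw [e, follows_append] at h
    exact h.1
  -- Here the code is one letter longer than the word: its final 3 is the return to the new base.
  · exact follows_append.2 ⟨h, follows_singleton.2 h'⟩
  · have e : keaneWord (m + 1) (n + 1) 3 = 3 :: 0 :: List.replicate n 2 ++ [2] := by
      simp [keaneWord, List.replicate_succ']
    change Follows _ _ _ (keaneWord (m + 1) (n + 1) 3) x at h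
    rw [e] at h
    exact h

/-- The second letter separates the new pieces 0, 1 from 2, 3, and the last letter separates within
each pair. With `m = 1` the second letter for piece 0 would be 2, hence `2 ≤ m`. -/
theorem keaneCode_unique (H : InducedExchange T u σ l b) (hm : 2 ≤ m) {i j : Fin 4} {x : UnitIco}
    (hi : Follows T (subPiece u σ l) b (keaneCode m n i) x)
    (hj : Follows T (subPiece u σ l) b (keaneCode m n j) x) : i = j := by
  obtain ⟨m, rfl⟩ := Nat.exists_eq_add_of_le' hm
  have second : ∀ i, Follows T (subPiece u σ l) b (keaneCode (m + 2) n i) x →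
      T^[b 3] x ∈ subPiece u σ l (![1, 1, 0, 0] i) := by
    intro i hi
    fin_cases i <;> exact hi.2.1
  have hs := H.subPiece_unique _ _ _ (second i hi) (second j hj)
  have last : ∀ (w : List (Fin 4)) (p q : Fin 4), p ≠ q →
      Follows T (subPiece u σ l) b (w ++ [p]) x →
      Follows T (subPiece u σ l) b (w ++ [q]) x → False := fun w p q hpq hp hq =>
    hpq (Follows.eq_of_append_singleton H.subPiece_unique hp hq)
  fin_cases i <;> fin_cases j <;> first
    | rfl
    | exact absurd hs (by decide)
    | exact (last _ _ _ (by decide) hi hj).elim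

theorem isOpen_subPiece_next [TopologicalSpace UnitIco] (hT : Continuous T)
    (H : InducedExchange T u σ l b) (hm : 2 ≤ m) (hn : 1 ≤ n) (hpos : ∀ j, 0 < l' j)
    (hl : ∀ i, l i = ∑ j, (keaneMatrix m n i j : ℝ) * l' j)
    (ho : ∀ j, IsOpen (subPiece u σ l j)) (j : Fin 4) :
    IsOpen (subPiece (u + σ * totalLength l) (-σ) l' j) := by
  have hm' : 1 ≤ m := by omega
  have e : subPiece (u + σ * totalLength l) (-σ) l' j =
      {x | Follows T (subPiece u σ l) b (keaneCode m n j) x} := by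
    refine subset_antisymm (fun x hx => H.follows_keaneCode hm' hn hpos hl hx) fun x hx => ?_
    have hx3 : x ∈ subPiece u σ l 3 := by
      have hx' : Follows T (subPiece u σ l) b (keaneCode m n j) x := hx
      fin_cases j <;> exact hx'.1
    rw [← baseInterval_reverse hl, ← (H.next hm' hn hpos hl).iUnion_subPiece,
      Set.mem_iUnion] at hx3
    obtain ⟨i, hi⟩ := hx3
    rwa [← H.keaneCode_unique hm (H.follows_keaneCode hm' hn hpos hl hi) hx]
  rw [e]
  exact isOpen_follows hT ho _

end InducedExchange

/-! ### Arithmetic choice of the parameters -/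

theorem nextTime_zero (m n : ℕ) (b : Fin 4 → ℕ) :
    nextTime m n b 0 = (m - 1) * b 1 + n * b 2 + b 3 := by
  simp [nextTime, Fin.sum_univ_four, keaneMatrix]

theorem nextTime_one (m n : ℕ) (b : Fin 4 → ℕ) :
    nextTime m n b 1 = m * b 1 + n * b 2 + b 3 := by
  simp [nextTime, Fin.sum_univ_four, keaneMatrix]

theorem nextTime_two (m n : ℕ) (b : Fin 4 → ℕ) :
    nextTime m n b 2 = b 0 + (n - 1) * b 2 + b 3 := by
  simp [nextTime, Fin.sum_univ_four, keaneMatrix]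

theorem nextTime_three (m n : ℕ) (b : Fin 4 → ℕ) :
    nextTime m n b 3 = b 0 + n * b 2 + b 3 := by
  simp [nextTime, Fin.sum_univ_four, keaneMatrix]

/-- If more than half of the residues are units, then some two units have a given difference. -/
theorem exists_isUnit_isUnit_add {P : ℕ} (hP : P < 2 * P.totient) (a : ZMod P) :
    ∃ y : ZMod P, IsUnit y ∧ IsUnit (y + a) := by
  classical
  have hP0 : P ≠ 0 := by rintro rfl; simp at hP
  have : NeZero P := ⟨hP0⟩
  set s : Finset (ZMod P) := Finset.univ.filter IsUnit with hs
  have hcard : P.totient ≤ s.card := by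
    rw [← ZMod.card_units_eq_totient P, ← Finset.card_univ,
      ← Finset.card_image_of_injective Finset.univ (Units.val_injective (α := ZMod P))]
    refine Finset.card_le_card fun y hy => ?_
    obtain ⟨z, -, rfl⟩ := Finset.mem_image.1 hy
    simp [hs]
  have hcard' : (s.image fun z => z - a).card = s.card :=
    Finset.card_image_of_injective _ (sub_left_injective (b := a))
  obtain ⟨y, hy⟩ := Finset.inter_nonempty_of_card_lt_card_add_card
    (Finset.subset_univ s) (Finset.subset_univ (s.image fun z => z - a))
    (by rw [Finset.card_univ, ZMod.card, hcard']; omega)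
  rw [Finset.mem_inter, Finset.mem_image] at hy
  obtain ⟨hy, z, hz, rfl⟩ := hy
  refine ⟨_, (Finset.mem_filter.1 hy).2, ?_⟩
  rw [sub_add_cancel]
  exact (Finset.mem_filter.1 hz).2

/-- The arithmetic properties of the return times `b` of a stage, where `P` is the product of the
return times of the second pieces up to this stage. -/
structure Admissible (b : Fin 4 → ℕ) (P : ℕ) : Prop where
  pos : ∀ j, 0 < b j
  le : b 0 ≤ b 1
  prime : (b 1).Prime
  dvd : b 1 ∣ P
  coprime : (b 2).Coprime P
  units : P < 2 * P.totient

/-- Modulo `P`, put `y = n * b 2 + b 3`. The next third return time is `y + b 0 - b 2`, and the next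
second one is `y + m * b 1`. If `y` and `y + b 0 - b 2` are units, the former is coprime to `P` and
the latter runs through a progression containing primes. The number `c` stands for `b_{k-1,4}`. -/
theorem Admissible.exists_next {b : Fin 4 → ℕ} {P : ℕ} (H : Admissible b P) (c : ℕ) :
    ∃ m n, 2 ≤ m ∧ 2 ≤ n ∧
      b 1 * nextTime m n b 2 + nextTime m n b 2 + b 3 + c < m * b 1 ∧
      b 2 * b 1 + b 1 < n * b 2 ∧
      Admissible (nextTime m n b) (P * nextTime m n b 1) := by
  have hP0 : 0 < P := Nat.pos_of_ne_zero (by rintro rfl; simpa using H.units)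
  have : NeZero P := ⟨hP0.ne'⟩
  obtain ⟨y, hy, hya⟩ := exists_isUnit_isUnit_add H.units ((b 0 : ZMod P) - b 2)
  -- `b 2` is invertible modulo `P`, so `n` can realise any residue `y`; the added multiple of `P`
  -- makes `n` large enough for the growth condition.
  obtain ⟨n, hn, hny⟩ : ∃ n : ℕ, 2 * b 1 + 2 ≤ n ∧ (n : ZMod P) * b 2 + b 3 = y := by
    refine ⟨((y - b 3) * (b 2 : ZMod P)⁻¹).val + P * (2 * b 1 + 2), ?_, ?_⟩
    · nlinarith [Nat.zero_le ((y - b 3) * (b 2 : ZMod P)⁻¹).val]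
    · push_cast
      rw [ZMod.natCast_zmod_val, ZMod.natCast_self, zero_mul, add_zero, mul_assoc,
        mul_comm (_⁻¹), ZMod.coe_mul_inv_eq_one _ H.coprime]
      ring
  obtain ⟨D, hD⟩ : ∃ D, D = b 0 + (n - 1) * b 2 + b 3 := ⟨_, rfl⟩
  have hDP : D.Coprime P := by
    rw [← ZMod.isUnit_iff_coprime]
    have : (D : ZMod P) = y + (b 0 - b 2) := by
      rw [hD, ← hny]
      push_cast [Nat.cast_sub (show 1 ≤ n by omega)]
      ring
    rwa [this]
  have hA : (n * b 2 + b 3).Coprime (b 1) := by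
    refine Nat.Coprime.coprime_dvd_right H.dvd ?_
    rw [← ZMod.isUnit_iff_coprime]
    push_cast
    rwa [hny]
  -- The summands of the bound serve, in order: positivity of `m`, its growth condition together
  -- with `p ∤ D`, `2 ≤ m`, `p ∤ P`, and units remaining a majority after multiplying `P` by `p`.
  obtain ⟨p, hp, hpp, hmod⟩ := Nat.forall_exists_prime_gt_and_modEq
    ((n * b 2 + b 3) + (b 1 * D + D + b 3 + c) + 2 * b 1 + P + 2 * P.totient)
    H.prime.ne_zero hA
  obtain ⟨m, hm⟩ := (Nat.modEq_iff_dvd' (by omega)).1 hmod.symm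
  have hpm : p = m * b 1 + n * b 2 + b 3 := by
    rw [mul_comm m]; omega
  have hb1 := H.pos 1
  have hb2 := H.pos 2
  have hb3 := H.pos 3
  have hD0 : 0 < D := by omega
  have hpP : p.Coprime P := (Nat.Prime.coprime_iff_not_dvd hpp).2 fun h =>
    absurd (Nat.le_of_dvd hP0 h) (by omega)
  have hpD : p.Coprime D := (Nat.Prime.coprime_iff_not_dvd hpp).2 fun h =>
    absurd (Nat.le_of_dvd hD0 h) (by omega)
  refine ⟨m, n, ?_, by omega, ?_, ?_, ?_⟩
  · have : 2 * b 1 < m * b 1 := by omega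
    exact (lt_of_mul_lt_mul_right this hb1.le).le
  · rw [nextTime_two, ← hD]
    omega
  · nlinarith
  · constructor
    · intro j
      fin_cases j
      · exact (Nat.add_pos_right _ hb3).trans_eq (nextTime_zero m n b).symm
      · exact (Nat.add_pos_right _ hb3).trans_eq (nextTime_one m n b).symm
      · exact (Nat.add_pos_right _ hb3).trans_eq (nextTime_two m n b).symm
      · exact (Nat.add_pos_right _ hb3).trans_eq (nextTime_three m n b).symm
    · rw [nextTime_zero, nextTime_one]
      have := Nat.mul_le_mul_right (b 1) (Nat.sub_le m 1)
      omega
    · rwa [nextTime_one, ← hpm]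
    · exact dvd_mul_left _ _
    · rw [nextTime_two, nextTime_one, ← hpm, ← hD]
      exact Nat.Coprime.mul_right hDP hpD.symm
    · rw [nextTime_one, ← hpm, Nat.totient_mul hpP.symm, Nat.totient_prime hpp]
      have h1 := H.units
      obtain ⟨q, rfl⟩ := Nat.exists_eq_add_of_le' hpp.one_le
      simp only [Nat.add_sub_cancel]
      nlinarith

/-- The return times determined by the parameters. -/
def returnTime (m n : ℕ → ℕ) : ℕ → Fin 4 → ℕ
  | 0 => fun _ => 1
  | k + 1 => nextTime (m k) (n k) (returnTime m n k)

/-- At stage 0 all return times are 1, which is not prime, so the induction starts at stage 1. There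
the parameters 4, 2 give return times 6, 7, 3, 4. -/
theorem admissible_first : Admissible (nextTime 4 2 fun _ => 1) 7 where
  pos j := by fin_cases j <;> decide
  le := by decide
  prime := by rw [nextTime_one]; norm_num
  dvd := by rw [nextTime_one]
  coprime := by rw [nextTime_two]; decide
  units := by rw [Nat.totient_prime (by norm_num)]; norm_num

/-- There are parameters for which all stages are admissible and the growth conditions hold. -/
theorem exists_admissible_parameters : ∃ m n : ℕ → ℕ, (∀ k, 2 ≤ m k) ∧ (∀ k, 2 ≤ n k) ∧
    (∀ k, 1 ≤ k → Admissible (returnTime m n k) (∏ i ∈ Finset.Icc 1 k, returnTime m n i 1)) ∧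
    ∀ k, 1 ≤ k →
      returnTime m n k 1 * returnTime m n (k + 1) 2 + returnTime m n (k + 1) 2 +
          returnTime m n k 3 + returnTime m n (k - 1) 3 < m k * returnTime m n k 1 ∧
        returnTime m n k 2 * returnTime m n k 1 + returnTime m n k 1 <
          n k * returnTime m n k 2 := by
  choose! f g hf hg h₁ h₂ hfg using
    fun (s : (Fin 4 → ℕ) × ℕ × ℕ) (H : Admissible s.1 s.2.1) => H.exists_next s.2.2
  -- The state holds the return times, the product of the primes so far, and the previous stage's `b
  -- 3`, which enters the growth condition.
  let next : (Fin 4 → ℕ) × ℕ × ℕ → (Fin 4 → ℕ) × ℕ × ℕ := fun s =>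
    (nextTime (f s) (g s) s.1, s.2.1 * nextTime (f s) (g s) s.1 1, s.1 3)
  let S : ℕ → (Fin 4 → ℕ) × ℕ × ℕ := fun k => next^[k] (nextTime 4 2 fun _ => 1, 7, 1)
  have hS : ∀ k, S (k + 1) = next (S k) := fun k => Function.iterate_succ_apply' _ _ _
  have hadm : ∀ k, Admissible (S k).1 (S k).2.1 := by
    intro k
    induction k with
    | zero => exact admissible_first
    | succ k ih => rw [hS]; exact hfg _ ih
  let m : ℕ → ℕ := fun k => Nat.casesOn k 4 fun k => f (S k)
  let n : ℕ → ℕ := fun k => Nat.casesOn k 2 fun k => g (S k)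
  have hb : ∀ k, returnTime m n (k + 1) = (S k).1 := by
    intro k
    induction k with
    | zero => rfl
    | succ k ih =>
      rw [hS]
      change nextTime (f (S k)) (g (S k)) (returnTime m n (k + 1)) = _
      rw [ih]
  have hP : ∀ k, ∏ i ∈ Finset.Icc 1 (k + 1), returnTime m n i 1 = (S k).2.1 := by
    intro k
    induction k with
    | zero =>
      simp only [zero_add, Finset.Icc_self, Finset.prod_singleton]
      exact nextTime_one _ _ _
    | succ k ih =>
      rw [Finset.prod_Icc_succ_top (by omega), ih, hb, hS]
  have hc : ∀ k, returnTime m n k 3 = (S k).2.2 := by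
    intro k
    cases k with
    | zero => rfl
    | succ k => rw [hb, hS]
  refine ⟨m, n, ?_, ?_, ?_, ?_⟩
  · rintro (_ | k)
    · exact (by norm_num : 2 ≤ 4)
    · exact hf _ (hadm k)
  · rintro (_ | k)
    · exact le_rfl
    · exact hg _ (hadm k)
  · rintro (_ | k) hk
    · omega
    · rw [hP, hb]; exact hadm k
  · rintro (_ | k) hk
    · omega
    · rw [Nat.add_sub_cancel, hc k, hb, hb, hS]
      exact ⟨h₁ _ (hadm k), h₂ _ (hadm k)⟩

/-- Nonnegative combinations `p a + q c` of coprime `a`, `c` with bounded coefficients. -/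
theorem exists_eq_mul_add_mul {a c p₀ q₀ N : ℕ} (ha : 0 < a) (hc : 0 < c) (h : a.Coprime c)
    (hN : a * c ≤ N) (hp : c ≤ p₀) (hq : N ≤ q₀ * c) :
    ∃ p q, p ≤ p₀ ∧ q ≤ q₀ ∧ N = p * a + q * c := by
  -- Solving `p * a ≡ N` modulo `c` with `p < c` keeps `p * a` below `a * c ≤ N`, so the remainder
  -- is a nonnegative multiple of `c`.
  obtain ⟨p, hpa, hpN⟩ : ∃ p, p < c ∧ p * a ≡ N [MOD c] := by
    obtain ⟨x, hx0, hxN⟩ := Nat.chineseRemainder h 0 N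
    obtain ⟨t, rfl⟩ := (Nat.modEq_zero_iff_dvd).1 hx0
    refine ⟨t % c, Nat.mod_lt _ hc, ?_⟩
    rw [mul_comm a] at hxN
    exact ((Nat.mod_modEq t c).mul_right a).trans hxN
  have hle : p * a ≤ N := by nlinarith
  obtain ⟨q, hq'⟩ := (Nat.modEq_iff_dvd' hle).1 hpN
  refine ⟨p, q, by omega, ?_, ?_⟩
  · have : q * c ≤ q₀ * c := by rw [mul_comm q]; omega
    exact le_of_mul_le_mul_right this hc
  · rw [mul_comm q]; omega

/-! ### Compatible lengths for all stages -/

/-- The product `A_{m_k,n_k} ⋯ A_{m_{k+r-1},n_{k+r-1}}` of Keane matrices applied to the vector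
`(1, 1, 1, 1)`. -/
def keaneProduct (m n : ℕ → ℕ) : ℕ → ℕ → Fin 4 → ℝ
  | 0, _ => fun _ => 1
  | r + 1, k => fun i => ∑ j, (keaneMatrix (m k) (n k) i j : ℝ) * keaneProduct m n r (k + 1) j

theorem keaneProduct_nonneg (m n : ℕ → ℕ) (r k : ℕ) (i : Fin 4) :
    0 ≤ keaneProduct m n r k i := by
  induction r generalizing k i with
  | zero => exact zero_le_one
  | succ r ih => exact Finset.sum_nonneg fun j _ => mul_nonneg (Nat.cast_nonneg _) (ih _ _)

theorem keaneProduct_succ_last (m n : ℕ → ℕ) (r k : ℕ) :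
    keaneProduct m n (r + 1) k 3 = ∑ j, keaneProduct m n r (k + 1) j := by
  simp [keaneProduct, Fin.sum_univ_four, keaneMatrix]

/-- The last row of a Keane matrix is all ones, so the total at one stage is a single entry at the
preceding stage. -/
theorem sum_keaneProduct_le (m n : ℕ → ℕ) (r k : ℕ) :
    ∑ j, keaneProduct m n r k j ≤ ∑ j, keaneProduct m n (k + r) 0 j := by
  induction k generalizing r with
  | zero => simp
  | succ k ih =>
    rw [← keaneProduct_succ_last, show k + 1 + r = k + (r + 1) by ring]
    exact (Finset.single_le_sum (fun i _ => keaneProduct_nonneg m n (r + 1) k i)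
      (Finset.mem_univ 3)).trans (ih _)

/-- There are positive length vectors of all stages that are compatible with the parameters. -/
theorem exists_keane_lengths {m n : ℕ → ℕ} (hm : ∀ k, 2 ≤ m k) (hn : ∀ k, 1 ≤ n k) :
    ∃ len : ℕ → Fin 4 → ℝ, (∀ k j, 0 < len k j) ∧ ∑ j, len 0 j = 1 ∧
      ∀ k i, len k i = ∑ j, (keaneMatrix (m k) (n k) i j : ℝ) * len (k + 1) j := by
  set S : ℕ → ℝ := fun K => ∑ j, keaneProduct m n K 0 j with hS
  have hS0 : ∀ K, 0 < S K := by
    intro K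
    have := sum_keaneProduct_le m n 0 K
    simp [keaneProduct] at this
    simp only [hS]
    linarith
  -- Truncate at stage `K`, starting there from the all-ones vector, and normalise so that stage 0
  -- has total 1. For `k ≤ K` all entries lie in `[0, 1]`.
  set v : ℕ → ℕ → Fin 4 → ℝ := fun K k j => keaneProduct m n (K - k) k j / S K with hv
  have hv01 : ∀ k j, ∀ K ≥ k, v K k j ∈ Set.Icc (0 : ℝ) 1 := by
    intro k j K hK
    refine ⟨div_nonneg (keaneProduct_nonneg _ _ _ _ _) (hS0 K).le, ?_⟩
    rw [hv, div_le_one (hS0 K)]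
    have := sum_keaneProduct_le m n (K - k) k
    rw [Nat.add_sub_cancel' hK] at this
    exact (Finset.single_le_sum (fun i _ => keaneProduct_nonneg m n (K - k) k i)
      (Finset.mem_univ j)).trans this
  -- One ultrafilter gives limits for all `k` and `j` at once, replacing a diagonal subsequence; the
  -- linear recursions survive the limit.
  have hlim : ∀ k j, ∃ x ∈ Set.Icc (0 : ℝ) 1,
      Tendsto (fun K => v K k j) (hyperfilter ℕ : Filter ℕ) (𝓝 x) := by
    intro k j
    refine isCompact_Icc.ultrafilter_le_nhds ((hyperfilter ℕ).map fun K => v K k j) ?_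
    rw [le_principal_iff]
    exact Nat.hyperfilter_le_atTop (eventually_atTop.2 ⟨k, hv01 k j⟩)
  choose len hlen01 hlen using hlim
  have hrec : ∀ k i, len k i = ∑ j, (keaneMatrix (m k) (n k) i j : ℝ) * len (k + 1) j := by
    intro k i
    refine tendsto_nhds_unique (hlen k i) (Tendsto.congr' ?_ (tendsto_finsetSum _
      fun j _ => (hlen (k + 1) j).const_mul _))
    refine Nat.hyperfilter_le_atTop (eventually_atTop.2 ⟨k + 1, fun K hK => ?_⟩)
    obtain ⟨r, rfl⟩ := Nat.exists_eq_add_of_le hK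
    simp only [hv]
    rw [show k + 1 + r - k = r + 1 by omega, show k + 1 + r - (k + 1) = r by omega,
      keaneProduct, Finset.sum_div]
    exact Finset.sum_congr rfl fun j _ => by ring
  have hsum : ∑ j, len 0 j = 1 := by
    refine tendsto_nhds_unique (tendsto_finsetSum _ fun j _ => hlen 0 j) ?_
    refine Tendsto.congr (fun K => ?_) tendsto_const_nhds
    simp only [hv]
    rw [← Finset.sum_div, Nat.sub_zero, div_self (hS0 K).ne']
  have h0 : ∀ k j, 0 ≤ len k j := fun k j => (hlen01 k j).1
  -- Limits are only known to be nonnegative. A stage that vanished would force the preceding one to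
  -- vanish; positive totals then give positive entries 3, 0, 2 and finally 1, the last using `m k -
  -- 1 > 0`.
  have ht : ∀ k, 0 < ∑ j, len k j := by
    intro k
    induction k with
    | zero => rw [hsum]; exact zero_lt_one
    | succ k ih =>
      refine (Finset.sum_nonneg fun j _ => h0 _ j).lt_of_ne' fun h => ih.ne' ?_
      have hz := (Finset.sum_eq_zero_iff_of_nonneg fun j _ => h0 (k + 1) j).1 h
      refine Finset.sum_eq_zero fun i _ => ?_
      rw [hrec]
      exact Finset.sum_eq_zero fun j hj => by rw [hz j hj, mul_zero]
  have h3 : ∀ k, 0 < len k 3 := by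
    intro k
    have : len k 3 = ∑ j, len (k + 1) j := by
      rw [hrec]; simp [Fin.sum_univ_four, keaneMatrix]
    rw [this]; exact ht _
  have hlb : ∀ k i, (keaneMatrix (m k) (n k) i 3 : ℝ) * len (k + 1) 3 ≤ len k i := by
    intro k i
    rw [hrec k i]
    exact Finset.single_le_sum (f := fun j => (keaneMatrix (m k) (n k) i j : ℝ) * len (k + 1) j)
      (fun j _ => mul_nonneg (Nat.cast_nonneg _) (h0 _ j)) (Finset.mem_univ 3)
  have hp0 : ∀ k, 0 < len k 0 := fun k => by
    have := hlb k 0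
    simp [keaneMatrix] at this
    exact (h3 _).trans_le this
  have hp2 : ∀ k, 0 < len k 2 := fun k => by
    have := hlb k 2
    simp [keaneMatrix] at this
    exact (mul_pos (Nat.cast_pos.2 (hn k)) (h3 _)).trans_le this
  have hp1 : ∀ k, 0 < len k 1 := fun k => by
    rw [hrec]
    refine (mul_pos ?_ (hp0 (k + 1))).trans_le (Finset.single_le_sum
      (f := fun j => (keaneMatrix (m k) (n k) 1 j : ℝ) * len (k + 1) j)
      (fun j _ => mul_nonneg (Nat.cast_nonneg _) (h0 _ j)) (Finset.mem_univ 0))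
    have := hm k
    rw [Nat.cast_pos]
    change 0 < m k - 1
    omega
  refine ⟨len, fun k j => ?_, hsum, hrec⟩
  fin_cases j
  exacts [hp0 k, hp1 k, hp2 k, h3 k]

/-- The total lengths of the stages decrease geometrically. -/
theorem totalLength_le_pow {m n : ℕ → ℕ} (hn : ∀ k, 2 ≤ n k) {len : ℕ → Fin 4 → ℝ}
    (hpos : ∀ k j, 0 < len k j) (hsum : ∑ j, len 0 j = 1)
    (hlen : ∀ k i, len k i = ∑ j, (keaneMatrix (m k) (n k) i j : ℝ) * len (k + 1) j) (k : ℕ) :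
    totalLength (len k) ≤ (1 / 2) ^ k := by
  induction k with
  | zero => rw [pow_zero, ← hsum, Fin.sum_univ_four, totalLength]
  | succ k ih =>
    have h2 := hlen k 2
    have h3 := hlen k 3
    simp only [Fin.sum_univ_four, keaneMatrix] at h2 h3
    simp at h2 h3
    rw [Nat.cast_sub (by have := hn k; omega)] at h2
    have hn' : (2 : ℝ) ≤ n k := by exact_mod_cast hn k
    have p := hpos (k + 1)
    have p0 := p 0
    have p1 := p 1
    have p3 := p 3
    have := mul_le_mul_of_nonneg_right hn' (p 0).le
    have := mul_le_mul_of_nonneg_right hn' (p 1).le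
    have := mul_le_mul_of_nonneg_right hn' (p 2).le
    have := mul_le_mul_of_nonneg_right hn' (p 3).le
    have := hpos k 0
    have := hpos k 1
    -- Pieces 2 and 3 of stage `k` each have at least the total length of stage `k + 1`, except that
    -- piece 2 needs `n k ≥ 2` for this.
    have : 2 * totalLength (len (k + 1)) ≤ totalLength (len k) := by
      simp only [totalLength]
      push_cast at h2
      linarith
    rw [pow_succ]
    linarith

/-! ### Towers over the stages -/

/-- The end of the base of the `k`-th stage at which its subintervals start. -/
def stageOrigin (len : ℕ → Fin 4 → ℝ) : ℕ → ℝ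
  | 0 => 0
  | k + 1 => stageOrigin len k + (-1) ^ k * totalLength (len k)

/-- The subinterval `I_j^(k)`. -/
def stagePiece (len : ℕ → Fin 4 → ℝ) (k : ℕ) (j : Fin 4) : Set UnitIco :=
  subPiece (stageOrigin len k) ((-1) ^ k) (len k) j

/-- The interval `I^(k)`. -/
def stageBase (len : ℕ → Fin 4 → ℝ) (k : ℕ) : Set UnitIco :=
  baseInterval (stageOrigin len k) ((-1) ^ k) (len k)

/-- At every stage `T` induces an exchange of the intervals with lengths `len k`, with the return
times determined by the parameters. -/
structure KeaneSystem (T : UnitIco → UnitIco) (m n : ℕ → ℕ) (len : ℕ → Fin 4 → ℝ) : Prop where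
  two_le_m : ∀ k, 2 ≤ m k
  two_le_n : ∀ k, 2 ≤ n k
  sum_len : ∑ j, len 0 j = 1
  len_eq : ∀ k i, len k i = ∑ j, (keaneMatrix (m k) (n k) i j : ℝ) * len (k + 1) j
  stage : ∀ k, InducedExchange T (stageOrigin len k) ((-1) ^ k) (len k) (returnTime m n k)

theorem KeaneSystem.of_first {T : UnitIco → UnitIco} {m n : ℕ → ℕ} {len : ℕ → Fin 4 → ℝ}
    (hm : ∀ k, 2 ≤ m k) (hn : ∀ k, 2 ≤ n k) (hpos : ∀ k j, 0 < len k j)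
    (hsum : ∑ j, len 0 j = 1)
    (hlen : ∀ k i, len k i = ∑ j, (keaneMatrix (m k) (n k) i j : ℝ) * len (k + 1) j)
    (h : InducedExchange T 0 1 (len 0) fun _ => 1) : KeaneSystem T m n len where
  two_le_m := hm
  two_le_n := hn
  sum_len := hsum
  len_eq := hlen
  stage k := by
    induction k with
    | zero => rwa [pow_zero]
    | succ k ih =>
      have := ih.next (one_le_two.trans (hm k)) (one_le_two.trans (hn k)) (hpos (k + 1)) (hlen k)
      rw [pow_succ, mul_neg_one]
      exact this

namespace KeaneSystem

variable {T : UnitIco → UnitIco} {m n : ℕ → ℕ} {len : ℕ → Fin 4 → ℝ}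

theorem one_le_m (H : KeaneSystem T m n len) (k : ℕ) : 1 ≤ m k := one_le_two.trans (H.two_le_m k)

theorem one_le_n (H : KeaneSystem T m n len) (k : ℕ) : 1 ≤ n k := one_le_two.trans (H.two_le_n k)

theorem stagePiece_succ (k : ℕ) (j : Fin 4) : stagePiece len (k + 1) j =
    subPiece (stageOrigin len k + (-1) ^ k * totalLength (len k)) (-(-1) ^ k) (len (k + 1)) j := by
  rw [stagePiece, pow_succ, mul_neg_one, stageOrigin]

theorem stageBase_succ (H : KeaneSystem T m n len) (k : ℕ) :
    stageBase len (k + 1) = stagePiece len k 3 := by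
  rw [stageBase, pow_succ, mul_neg_one]
  exact InducedExchange.baseInterval_reverse (H.len_eq k)

theorem stagePiece_subset (H : KeaneSystem T m n len) (k : ℕ) (j : Fin 4) :
    stagePiece len k j ⊆ stageBase len k := (H.stage k).subPiece_subset j

theorem stageBase_antitone (H : KeaneSystem T m n len) : Antitone (stageBase len) :=
  antitone_nat_of_succ_le fun k => by
    rw [H.stageBase_succ]
    exact H.stagePiece_subset k 3

theorem follows (H : KeaneSystem T m n len) {k : ℕ} {j : Fin 4} {x : UnitIco}
    (hx : x ∈ stagePiece len (k + 1) j) :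
    Follows T (stagePiece len k) (returnTime m n k) (keaneWord (m k) (n k) j) x := by
  rw [stagePiece_succ] at hx
  exact (H.stage k).follows_keaneWord (H.one_le_m k) (H.one_le_n k) (H.stage (k + 1)).pos
    (H.len_eq k) hx

theorem mem_base_zero (H : KeaneSystem T m n len) (x : UnitIco) : x ∈ stageBase len 0 := by
  have h := H.sum_len
  rw [Fin.sum_univ_four] at h
  simp only [stageBase, baseInterval, orientedIco, stageOrigin, totalLength, Set.mem_ofPred_eq,
    h, pow_zero]
  constructor <;> linarith [x.2.1, x.2.2]

theorem exists_base_iterate (H : KeaneSystem T m n len) (k : ℕ) (x : UnitIco) :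
    ∃ y ∈ stageBase len k, ∃ t, T^[t] y = x := by
  induction k with
  | zero => exact ⟨x, H.mem_base_zero x, 0, rfl⟩
  | succ k ih =>
    obtain ⟨y, hy, t, rfl⟩ := ih
    have hlt : len k 0 < len k 3 := by
      have h0 := H.len_eq k 0
      have h3 := H.len_eq k 3
      simp [Fin.sum_univ_four, keaneMatrix] at h0 h3
      have := (H.stage (k + 1)).pos 0
      have := (H.stage (k + 1)).pos 1
      linarith
    obtain ⟨z, hz, s, rfl⟩ := (H.stage k).exists_iterate_last hlt hy
    refine ⟨z, ?_, t + s, Function.iterate_add_apply _ _ _ _⟩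
    rw [H.stageBase_succ]
    exact hz

/-- Take the least time at which a point of the base reaches `x`. Were it at least the return time,
the return point would reach `x` sooner. -/
theorem exists_floor (H : KeaneSystem T m n len) (k : ℕ) (x : UnitIco) :
    ∃ j, ∃ y ∈ stagePiece len k j, ∃ t < returnTime m n k j, T^[t] y = x := by
  classical
  have hex : ∃ t, ∃ y ∈ stageBase len k, T^[t] y = x := by
    obtain ⟨y, hy, t, ht⟩ := H.exists_base_iterate k x
    exact ⟨t, y, hy, ht⟩
  obtain ⟨y, hy, hyx⟩ := Nat.find_spec hex
  have hmin := fun {t : ℕ} => Nat.find_min' hex (m := t)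
  generalize Nat.find hex = t at hyx hmin
  rw [stageBase, ← (H.stage k).iUnion_subPiece, Set.mem_iUnion] at hy
  obtain ⟨j, hj⟩ := hy
  refine ⟨j, y, hj, t, ?_, hyx⟩
  by_contra hlt
  obtain ⟨r, rfl⟩ := Nat.exists_eq_add_of_le (not_lt.1 hlt)
  have := hmin ⟨_, (H.stage k).iterate_mem_base hj, by
    rw [← Function.iterate_add_apply, add_comm, hyx]⟩
  have := (H.stage k).time_pos j
  omega

theorem abs_iterate_sub_lt (H : KeaneSystem T m n len) {k : ℕ} {j : Fin 4} {x y : UnitIco}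
    (hx : x ∈ stagePiece len k j) (hy : y ∈ stagePiece len k j) {t : ℕ}
    (ht : t ≤ returnTime m n k j) : |(T^[t] x : ℝ) - T^[t] y| < totalLength (len k) := by
  rw [(H.stage k).rigid j x hx y hy t ht]
  exact orientedIco.abs_sub_lt ((H.stage k).subPiece_subset j hx)
    ((H.stage k).subPiece_subset j hy)

theorem tendsto_totalLength (H : KeaneSystem T m n len) :
    Tendsto (fun k => totalLength (len k)) Filter.atTop (nhds 0) := by
  refine squeeze_zero (fun k => ?_) (totalLength_le_pow H.two_le_n (fun k => (H.stage k).pos)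
    H.sum_len H.len_eq) (tendsto_pow_atTop_nhds_zero_of_lt_one (by norm_num) (by norm_num))
  have h := (H.stage k).pos
  have := h 0
  have := h 1
  have := h 2
  have := h 3
  simp only [totalLength]
  linarith

theorem exists_floor_subset (H : KeaneSystem T m n len) {U : Set UnitIco} (hU : IsOpen U)
    {x : UnitIco} (hx : x ∈ U) : ∃ k j t, t < returnTime m n k j ∧
      x ∈ T^[t] '' stagePiece len k j ∧ T^[t] '' stagePiece len k j ⊆ U := by
  obtain ⟨ε, hε, hball⟩ := Metric.isOpen_iff.1 hU x hx
  obtain ⟨k, hk⟩ := (H.tendsto_totalLength.eventually_lt_const hε).exists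
  obtain ⟨j, y, hy, t, ht, rfl⟩ := H.exists_floor k x
  refine ⟨k, j, t, ht, Set.mem_image_of_mem _ hy, ?_⟩
  rintro _ ⟨z, hz, rfl⟩
  refine hball ?_
  rw [Metric.mem_ball, Subtype.dist_eq, Real.dist_eq]
  exact (H.abs_iterate_sub_lt hz hy ht.le).trans hk

/-- A point of the base of stage `k + 3` starts in piece 3 and then visits piece 0 of stage `k + 1`.
The words of these two pieces contain 3, 0, 2 and 1 respectively at fixed places, so the time does
not depend on the point. -/
theorem exists_visit (H : KeaneSystem T m n len) (k : ℕ) (j : Fin 4) :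
    ∃ r, ∀ x ∈ stageBase len (k + 3), T^[r] x ∈ stagePiece len k j := by
  have two : ∀ x ∈ stageBase len (k + 3), x ∈ stagePiece len (k + 1) 3 ∧
      T^[returnTime m n (k + 1) 3] x ∈ stagePiece len (k + 1) 0 := by
    intro x hx
    rw [H.stageBase_succ] at hx
    have h := H.follows hx
    exact ⟨h.1, h.2.1⟩
  obtain ⟨p, hp⟩ := Nat.exists_eq_add_of_le' (H.two_le_m k)
  obtain ⟨q, hq⟩ := Nat.exists_eq_add_of_le' (H.two_le_n k)
  have follows_zero : ∀ x ∈ stagePiece len (k + 1) 0,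
      T^[returnTime m n k 3] x ∈ stagePiece len k 1 := by
    intro x hx
    have h := H.follows hx
    rw [hp] at h
    exact h.2.1
  have follows_three : ∀ x ∈ stagePiece len (k + 1) 3, x ∈ stagePiece len k 3 ∧
      T^[returnTime m n k 3] x ∈ stagePiece len k 0 ∧
      T^[returnTime m n k 0] (T^[returnTime m n k 3] x) ∈ stagePiece len k 2 := by
    intro x hx
    have h := H.follows hx
    rw [hq] at h
    exact ⟨h.1, h.2.1, h.2.2.1⟩
  fin_cases j
  · exact ⟨_, fun x hx => (follows_three x (two x hx).1).2.1⟩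
  · refine ⟨returnTime m n k 3 + returnTime m n (k + 1) 3, fun x hx => ?_⟩
    rw [Function.iterate_add_apply]
    exact follows_zero _ (two x hx).2
  · refine ⟨returnTime m n k 0 + returnTime m n k 3, fun x hx => ?_⟩
    rw [Function.iterate_add_apply]
    exact (follows_three x (two x hx).1).2.2
  · exact ⟨0, fun x hx => (follows_three x (two x hx).1).1⟩

/-- Some time takes all points of a late base into a given nonempty open set. -/
theorem exists_iterate_mem_open (H : KeaneSystem T m n len) {U : Set UnitIco} (hU : IsOpen U)
    (hne : U.Nonempty) : ∃ K s, ∀ x ∈ stageBase len K, T^[s] x ∈ U := by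
  obtain ⟨x, hx⟩ := hne
  obtain ⟨k, j, t, -, -, hsub⟩ := H.exists_floor_subset hU hx
  obtain ⟨r, hr⟩ := H.exists_visit k j
  refine ⟨k + 3, t + r, fun y hy => ?_⟩
  rw [Function.iterate_add_apply]
  exact hsub (Set.mem_image_of_mem _ (hr y hy))

theorem stagePiece_nonempty (H : KeaneSystem T m n len) (k : ℕ) (j : Fin 4) :
    (stagePiece len k j).Nonempty := by
  have h := H.stage k
  have h0 := h.pos 0
  have h1 := h.pos 1
  have h2 := h.pos 2
  have h3 := h.pos 3
  have hj := h.pos j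
  have hx : stageOrigin len k + (-1) ^ k * (domStart (len k) j + len k j / 2) ∈
      orientedIco (stageOrigin len k) ((-1) ^ k) (domStart (len k) j) (len k j) := by
    simp only [orientedIco, Set.mem_ofPred_eq, sub_self]
    constructor <;> linarith
  exact ⟨⟨_, h.inside (orientedIco.mono (s' := 0) (w' := totalLength (len k)) h.sign
    (by fin_cases j <;> simp [domStart] <;> linarith)
    (by fin_cases j <;> simp [domStart, totalLength] <;> linarith) hx)⟩, hx⟩

/-! ### Return times and mixing -/

theorem iterate_mem_base_of_follows_append (H : KeaneSystem T m n len) {k : ℕ}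
    {w w' : List (Fin 4)} {x : UnitIco}
    (hx : Follows T (stagePiece len k) (returnTime m n k) (w ++ w') x)
    (h : T^[wordTime (returnTime m n k) (w ++ w')] x ∈ stageBase len k) :
    T^[wordTime (returnTime m n k) w] x ∈ stageBase len k := by
  cases w' with
  | nil => rwa [List.append_nil] at h
  | cons i w' => exact H.stagePiece_subset k i (follows_append.1 hx).2.1

theorem iterate_word_mem_base (H : KeaneSystem T m n len) {k : ℕ} {j : Fin 4} {x : UnitIco}
    (hx : x ∈ stagePiece len (k + 1) j) {w w' : List (Fin 4)}
    (hw : keaneWord (m k) (n k) j = w ++ w') :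
    T^[wordTime (returnTime m n k) w] x ∈ stageBase len k := by
  have h := H.follows hx
  rw [hw] at h
  refine H.iterate_mem_base_of_follows_append h ?_
  rw [← hw, wordTime_keaneWord]
  exact H.stageBase_antitone (Nat.le_succ k) ((H.stage (k + 1)).iterate_mem_base hx)

theorem keaneWord_one_eq {m n p q : ℕ} (hp : p ≤ m) (hq : q ≤ n) :
    keaneWord m n 1 = (3 :: List.replicate (m - p) 1) ++ (List.replicate p 1 ++
      (List.replicate q 2 ++ List.replicate (n - q) 2)) := by
  change 3 :: _ = _
  rw [← List.replicate_add, Nat.add_sub_cancel' hq, List.cons_append, ← List.append_assoc,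
    ← List.replicate_add, Nat.sub_add_cancel hp]

/-- Returns to the base along `p` visits of the second piece followed by `q` visits of the third. -/
theorem exists_return (H : KeaneSystem T m n len) (k : ℕ) {p q : ℕ} (hp : p ≤ m k)
    (hq : q ≤ n k) : ∃ x ∈ stageBase len k,
      T^[p * returnTime m n k 1 + q * returnTime m n k 2] x ∈ stageBase len k := by
  obtain ⟨x, hx⟩ := H.stagePiece_nonempty (k + 1) 1
  have e := keaneWord_one_eq hp hq
  refine ⟨_, H.iterate_word_mem_base hx e, ?_⟩
  rw [← Function.iterate_add_apply]
  rw [← List.append_assoc (List.replicate p 1), ← List.append_assoc] at e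
  have := H.iterate_word_mem_base hx e
  rw [wordTime_append, wordTime_append, wordTime_replicate, wordTime_replicate, add_comm] at this
  exact this

/-- Returns to the base along `p` visits of the second piece, all visits of the third piece, and
`q` visits of the third piece of the next stage. -/
theorem exists_long_return (H : KeaneSystem T m n len) (k : ℕ) {p q : ℕ} (hp : p ≤ m k)
    (hq : q ≤ n (k + 1)) : ∃ x ∈ stageBase len k,
      T^[p * returnTime m n k 1 + n k * returnTime m n k 2 + q * returnTime m n (k + 1) 2] x ∈
        stageBase len k := by
  obtain ⟨x, hx⟩ := H.stagePiece_nonempty (k + 2) 1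
  have e := keaneWord_one_eq (H.one_le_m (k + 1)) hq
  -- This is the last visit to piece 1 of stage `k + 1`, just before the run in piece 2. During it
  -- the orbit ends with `p` visits to piece 1 and all `n k` visits to piece 2 of stage `k`.
  have hy : T^[wordTime (returnTime m n (k + 1)) (3 :: List.replicate (m (k + 1) - 1) 1)] x ∈
      stagePiece len (k + 1) 1 := by
    have := H.follows hx
    rw [e, follows_append] at this
    exact this.2.1
  rw [← List.append_assoc (List.replicate 1 1), ← List.append_assoc] at e
  have hz := H.stageBase_antitone (Nat.le_succ k) (H.iterate_word_mem_base hx e)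
  have e' := keaneWord_one_eq hp le_rfl (n := n k)
  refine ⟨_, H.iterate_word_mem_base hy e', ?_⟩
  have ht : returnTime m n (k + 1) 1 = wordTime (returnTime m n k) (keaneWord (m k) (n k) 1) :=
    (wordTime_keaneWord _ _ _ _).symm
  rw [e'] at ht
  rw [← Function.iterate_add_apply, ← Function.iterate_add_apply]
  convert hz using 3
  simp only [wordTime_append, wordTime_replicate, wordTime_cons, one_mul, Nat.sub_self,
    zero_mul] at ht ⊢
  omega

/-- The windows `[a k * c k, a (k + 1) * c (k + 1))` cover all large times, and within each the
short returns overlap the long ones. Returns to a deeper base are returns to the base of stage `K`.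
-/
theorem eventually_return (H : KeaneSystem T m n len)
    (hadm : ∀ k, 1 ≤ k →
      Admissible (returnTime m n k) (∏ i ∈ Finset.Icc 1 k, returnTime m n i 1))
    (hg : ∀ k, 1 ≤ k →
      returnTime m n k 1 * returnTime m n (k + 1) 2 + returnTime m n (k + 1) 2 +
          returnTime m n k 3 + returnTime m n (k - 1) 3 < m k * returnTime m n k 1 ∧
        returnTime m n k 2 * returnTime m n k 1 + returnTime m n k 1 <
          n k * returnTime m n k 2) {K : ℕ} (hK : 1 ≤ K) :
    ∃ N₀, ∀ N ≥ N₀, ∃ x ∈ stageBase len K, T^[N] x ∈ stageBase len K := by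
  set a : ℕ → ℕ := fun k => returnTime m n k 1 with ha
  set c : ℕ → ℕ := fun k => returnTime m n k 2 with hc
  have ha0 : ∀ k, 0 < a k := fun k => (H.stage k).time_pos 1
  have hc0 : ∀ k, 0 < c k := fun k => (H.stage k).time_pos 2
  have hsucc : ∀ k, c (k + 1) = returnTime m n k 0 + (n k - 1) * c k + returnTime m n k 3 :=
    fun k => nextTime_two _ _ _
  have hgm : ∀ k, 1 ≤ k → a k * c (k + 1) + c (k + 1) + returnTime m n k 3 +
      returnTime m n (k - 1) 3 < m k * a k := fun k hk => (hg k hk).1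
  have hgn : ∀ k, 1 ≤ k → c k * a k + a k < n k * c k := fun k hk => (hg k hk).2
  have hgrow : ∀ k, k ≤ a k := by
    intro k
    induction k with
    | zero => exact Nat.zero_le _
    | succ k ih =>
      have e : a (k + 1) = m k * a k + n k * c k + returnTime m n k 3 := nextTime_one _ _ _
      have := Nat.le_mul_of_pos_left (a k) (H.one_le_m k)
      have := (H.stage k).time_pos 3
      omega
  have hac : ∀ k, 1 ≤ k → (a k).Coprime (c k) := fun k hk =>
    ((hadm k hk).coprime.coprime_dvd_right (hadm k hk).dvd).symm
  have hac' : ∀ k, 1 ≤ k → (a k).Coprime (c (k + 1)) := fun k hk =>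
    ((hadm (k + 1) (by omega)).coprime.coprime_dvd_right
      (Finset.dvd_prod_of_mem (fun i => returnTime m n i 1)
        (Finset.mem_Icc.2 ⟨hk, Nat.le_succ k⟩))).symm
  have han : ∀ k, 1 ≤ k → a k ≤ n k := by
    intro k hk
    have h : a k * c k < n k * c k := by rw [mul_comm (a k)]; have := hgn k hk; omega
    exact (lt_of_mul_lt_mul_right h (Nat.zero_le _)).le
  have hcm : ∀ k, 1 ≤ k → c (k + 1) ≤ m k := by
    intro k hk
    have h : c (k + 1) * a k < m k * a k := by rw [mul_comm (c _)]; have := hgm k hk; omega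
    exact (lt_of_mul_lt_mul_right h (Nat.zero_le _)).le
  -- The long returns start no later than the short ones stop. In the growth condition `c (k + 1)`
  -- bounds `(n k - 1) * c k`, and `returnTime m n k 3` bounds the remaining `c k`.
  have hover : ∀ k, 1 ≤ k → n k * c k + a k * c (k + 1) ≤ m k * a k := by
    intro k hk
    have h := hgm k hk
    have hle : c k ≤ returnTime m n k 3 := by
      obtain ⟨r, rfl⟩ := Nat.exists_eq_add_of_le' hk
      have h3 : returnTime m n (r + 1) 3
        = returnTime m n r 0 + n r * c r + returnTime m n r 3 := nextTime_three _ _ _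
      rw [hsucc, h3]
      have := Nat.mul_le_mul_right (c r) (Nat.sub_le (n r) 1)
      omega
    have hn1 : n k * c k = (n k - 1) * c k + c k := by
      obtain ⟨q, hq⟩ := Nat.exists_eq_add_of_le' (H.one_le_n k)
      rw [hq, Nat.add_sub_cancel, add_mul, one_mul]
    have := hsucc k
    omega
  have hnext : ∀ k, 1 ≤ k → a k * c k ≤ n k * c k := fun k hk =>
    Nat.mul_le_mul_right _ (han k hk)
  refine ⟨a K * c K, fun N hN => ?_⟩
  suffices ∃ k ≥ K, ∃ x ∈ stageBase len k, T^[N] x ∈ stageBase len k by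
    obtain ⟨k, hk, x, hx, hx'⟩ := this
    exact ⟨x, H.stageBase_antitone hk hx, H.stageBase_antitone hk hx'⟩
  have key : ∀ d, N < a (K + d) * c (K + d) →
      ∃ k ≥ K, ∃ x ∈ stageBase len k, T^[N] x ∈ stageBase len k := by
    intro d
    induction d with
    | zero => intro h; exact absurd hN (not_le.2 h)
    | succ d ih =>
      intro h
      by_cases hd : N < a (K + d) * c (K + d)
      · exact ih hd
      push Not at hd
      rw [← add_assoc] at h
      have hk : 1 ≤ K + d := by omega
      refine ⟨K + d, by omega, ?_⟩
      generalize K + d = k at hd h hk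
      -- Up to `m k * a k` short returns suffice. Beyond it, `n k * c k` is subtracted and the rest
      -- is represented by `a k` and `c (k + 1)`.
      by_cases hm : N ≤ m k * a k
      · obtain ⟨q, p, hq, hp, rfl⟩ := exists_eq_mul_add_mul (hc0 k) (ha0 k) (hac k hk).symm
          (by rwa [mul_comm]) (han k hk) hm
        rw [add_comm]
        exact H.exists_return k hp hq
      · have h1 := hover k hk
        have h2 := hnext (k + 1) (by omega)
        obtain ⟨M, rfl⟩ := Nat.exists_eq_add_of_le (show n k * c k ≤ N by omega)
        obtain ⟨p, q, hp, hq, rfl⟩ := exists_eq_mul_add_mul (N := M) (q₀ := n (k + 1)) (ha0 k)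
          (hc0 (k + 1)) (hac' k hk) (by omega) (hcm k hk) (by omega)
        rw [show n k * c k + (p * a k + q * c (k + 1)) = p * a k + n k * c k + q * c (k + 1) by ring]
        exact H.exists_long_return k hp hq
  refine key (N + 1) ?_
  have h1 := hgrow (K + (N + 1))
  have h2 := Nat.le_mul_of_pos_right (a (K + (N + 1))) (hc0 (K + (N + 1)))
  omega

theorem topologicallyMixing (H : KeaneSystem T m n len)
    (hret : ∀ K, 1 ≤ K → ∃ N₀, ∀ N ≥ N₀, ∃ x ∈ stageBase len K, T^[N] x ∈ stageBase len K) :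
    TopologicallyMixing T := by
  intro U V hU hV hUne hVne
  obtain ⟨K₁, s, hs⟩ := H.exists_iterate_mem_open hU hUne
  obtain ⟨K₂, r, hr⟩ := H.exists_iterate_mem_open hV hVne
  obtain ⟨N₀, hN₀⟩ := hret (max K₁ K₂ + 1) (by omega)
  refine ⟨N₀ + r, fun N hN => ?_⟩
  -- Entering `U` costs `s` steps and `V` is entered `r` steps after the return, so a return after
  -- `N + s - r` steps gives exactly `N` steps from `U` to `V`.
  obtain ⟨x, hx, hx'⟩ := hN₀ (N + s - r) (by omega)
  refine ⟨T^[N] (T^[s] x), Set.mem_image_of_mem _ (hs x (H.stageBase_antitone (by omega) hx)), ?_⟩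
  have e : N + s = r + (N + s - r) := by omega
  rw [← Function.iterate_add_apply, e, Function.iterate_add_apply]
  exact hr _ (H.stageBase_antitone (by omega) hx')

end KeaneSystem

/-! ### The symbolic topology -/

namespace LengthVector

variable {n : ℕ}

theorem iet_lt_iet (L : LengthVector n) (π : Equiv.Perm (Fin n)) {x y : UnitIco} {i j : Fin n}
    (hx : x ∈ L.piece i) (hy : y ∈ L.piece j) (h : π i < π j) : L.iet π x < L.iet π y := by
  classical
  rw [← Subtype.coe_lt_coe, L.iet_apply π hx, L.iet_apply π hy]
  have h1 : L.1 i + ∑ k with π k < π i, L.1 k ≤ ∑ k with π k < π j, L.1 k := by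
    rw [← Finset.sum_insert (s := Finset.univ.filter fun k : Fin n => π k < π i) (by simp)]
    refine Finset.sum_le_sum_of_subset_of_nonneg ?_ (fun k _ _ => (L.2.1 k).le)
    intro k hk
    simp only [Finset.mem_insert, Finset.mem_filter, Finset.mem_univ, true_and] at hk ⊢
    rcases hk with rfl | hk
    · exact h
    · exact hk.trans h
  have h2 := hx.2
  have h3 := hy.1
  simp only [leftEnd] at h2 h3
  linarith

theorem iet_injective (L : LengthVector n) (π : Equiv.Perm (Fin n)) :
    Function.Injective (L.iet π) := by
  intro x y hxy
  have hx := L.mem_piece_index x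
  have hy := L.mem_piece_index y
  rcases lt_trichotomy (π (L.index x)) (π (L.index y)) with h | h | h
  · exact absurd hxy (L.iet_lt_iet π hx hy h).ne
  · rw [← π.injective h] at hy
    have := congrArg Subtype.val hxy
    rw [L.iet_apply π hx, L.iet_apply π hy] at this
    exact Subtype.ext (by linarith)
  · exact absurd hxy (L.iet_lt_iet π hy hx h).ne'

theorem isOpen_preimage_piece (L : LengthVector n) (π : Equiv.Perm (Fin n)) (i : ℕ) (j : Fin n) :
    IsOpen[L.symbolicTopology π] ((L.iet π)^[i] ⁻¹' L.piece j) :=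
  TopologicalSpace.isOpen_generateFrom_of_mem ⟨i, j, Or.inl rfl⟩

theorem isOpen_image_piece (L : LengthVector n) (π : Equiv.Perm (Fin n)) (i : ℕ) (j : Fin n) :
    IsOpen[L.symbolicTopology π] ((L.iet π)^[i] '' L.piece j) :=
  TopologicalSpace.isOpen_generateFrom_of_mem ⟨i, j, Or.inr rfl⟩

theorem isOpen_piece (L : LengthVector n) (π : Equiv.Perm (Fin n)) (j : Fin n) :
    IsOpen[L.symbolicTopology π] (L.piece j) := L.isOpen_preimage_piece π 0 j

theorem continuous_iet (L : LengthVector n) (π : Equiv.Perm (Fin n)) :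
    Continuous[L.symbolicTopology π, L.symbolicTopology π] (L.iet π) := by
  refine continuous_generateFrom_iff.2 ?_
  rintro _ ⟨i, j, rfl | rfl⟩
  · rw [← Set.preimage_comp, ← Function.iterate_succ]
    exact L.isOpen_preimage_piece π (i + 1) j
  · cases i with
    | zero =>
      rw [Function.iterate_zero, Set.image_id]
      exact L.isOpen_preimage_piece π 1 j
    | succ i =>
      rw [Function.iterate_succ', Set.image_comp,
        Set.preimage_image_eq _ (L.iet_injective π)]
      exact L.isOpen_image_piece π i j

theorem isOpen_range_iet (L : LengthVector n) (π : Equiv.Perm (Fin n)) :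
    IsOpen[L.symbolicTopology π] (Set.range (L.iet π)) := by
  have : Set.range (L.iet π) = ⋃ j, (L.iet π)^[1] '' L.piece j := by
    ext y
    simp only [Set.mem_range, Set.mem_iUnion, Set.mem_image, Function.iterate_one]
    constructor
    · rintro ⟨x, rfl⟩
      exact ⟨_, x, L.mem_piece_index x, rfl⟩
    · rintro ⟨_, x, _, rfl⟩
      exact ⟨x, rfl⟩
  rw [this]
  exact @isOpen_iUnion _ _ (L.symbolicTopology π) _ fun j => L.isOpen_image_piece π 1 j

/-- Injectivity lets images commute with intersections. Surjectivity is bypassed, since the range is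
a union of generators. -/
theorem isOpen_image_iet (L : LengthVector n) (π : Equiv.Perm (Fin n)) {U : Set UnitIco}
    (hU : IsOpen[L.symbolicTopology π] U) : IsOpen[L.symbolicTopology π] (L.iet π '' U) := by
  let _ := L.symbolicTopology π
  induction hU with
  | basic s hs =>
    obtain ⟨i, j, rfl | rfl⟩ := hs
    · cases i with
      | zero => exact L.isOpen_image_piece π 1 j
      | succ i =>
        rw [Function.iterate_succ, Set.preimage_comp, Set.image_preimage_eq_inter_range]
        exact IsOpen.inter (L.isOpen_preimage_piece π i j) (L.isOpen_range_iet π)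
    · rw [← Set.image_comp, ← Function.iterate_succ']
      exact L.isOpen_image_piece π (i + 1) j
  | univ =>
    rw [Set.image_univ]
    exact L.isOpen_range_iet π
  | inter s t _ _ hs ht =>
    rw [Set.image_inter (L.iet_injective π)]
    exact IsOpen.inter hs ht
  | sUnion S _ hS =>
    rw [Set.sUnion_eq_biUnion, Set.image_iUnion₂]
    exact isOpen_biUnion hS

theorem isOpen_image_iterate_iet (L : LengthVector n) (π : Equiv.Perm (Fin n)) {U : Set UnitIco}
    (hU : IsOpen[L.symbolicTopology π] U) (t : ℕ) :
    IsOpen[L.symbolicTopology π] ((L.iet π)^[t] '' U) := by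
  induction t with
  | zero => simpa using hU
  | succ t ih =>
    rw [Function.iterate_succ', Set.image_comp]
    exact L.isOpen_image_iet π ih

end LengthVector

/-! ### From standard to symbolic mixing -/

/-- With every point, the set contains an interval starting at that point. -/
def IsRightOpen (W : Set UnitIco) : Prop :=
  ∀ x ∈ W, ∃ ε > 0, ∀ y : UnitIco, x ≤ y → (y : ℝ) < x + ε → y ∈ W

namespace IsRightOpen

theorem inter {W W' : Set UnitIco} (h : IsRightOpen W) (h' : IsRightOpen W') :
    IsRightOpen (W ∩ W') := by
  rintro x ⟨hx, hx'⟩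
  obtain ⟨ε, hε, H⟩ := h x hx
  obtain ⟨δ, hδ, H'⟩ := h' x hx'
  refine ⟨min ε δ, lt_min hε hδ, fun y hxy hy => ⟨H y hxy ?_, H' y hxy ?_⟩⟩
  · linarith [min_le_left ε δ]
  · linarith [min_le_right ε δ]

variable {n : ℕ} (L : LengthVector n) (π : Equiv.Perm (Fin n)) {W : Set UnitIco}

theorem piece (j : Fin n) : IsRightOpen (L.piece j) := fun x hx =>
  ⟨L.leftEnd j + L.1 j - x, sub_pos.2 hx.2, fun y hxy hy =>
    ⟨hx.1.trans hxy, by linarith⟩⟩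

theorem preimage_iet (h : IsRightOpen W) : IsRightOpen (L.iet π ⁻¹' W) := by
  intro x hx
  have hxi := L.mem_piece_index x
  obtain ⟨δ, hδ, H⟩ := piece L _ x hxi
  obtain ⟨ε, hε, H'⟩ := h _ hx
  refine ⟨min ε δ, lt_min hε hδ, fun y hxy hy => ?_⟩
  have hyi := H y hxy (by linarith [min_le_right ε δ])
  have hxy' : (x : ℝ) ≤ y := hxy
  refine H' _ ?_ ?_
  · rw [← Subtype.coe_le_coe, L.iet_apply π hxi, L.iet_apply π hyi]
    linarith
  · rw [L.iet_apply π hxi, L.iet_apply π hyi]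
    linarith [min_le_left ε δ]

theorem image_iet (h : IsRightOpen W) : IsRightOpen (L.iet π '' W) := by
  rintro _ ⟨x, hx, rfl⟩
  have hxi := L.mem_piece_index x
  obtain ⟨ε, hε, H⟩ := h.inter (piece L _) x ⟨hx, hxi⟩
  refine ⟨min ε (1 - x), lt_min hε (sub_pos.2 x.2.2), fun y hxy hy => ?_⟩
  have hxy' : ((L.iet π x : UnitIco) : ℝ) ≤ y := hxy
  have h1 := min_le_left ε (1 - x)
  have h2 := min_le_right ε (1 - x)
  have hz : (x : ℝ) + (y - L.iet π x) ∈ Set.Ico (0 : ℝ) 1 := by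
    constructor
    · linarith [x.2.1]
    · linarith
  have hzW := H ⟨_, hz⟩ (by rw [← Subtype.coe_le_coe]; linarith) (by
    change (x : ℝ) + (y - L.iet π x) < _
    linarith)
  refine ⟨_, hzW.1, Subtype.ext ?_⟩
  rw [L.iet_apply π hzW.2]
  have := L.iet_apply π hxi
  simp only
  linarith

/-- Pieces contain their left ends and `T` is a translation on each, so both images and preimages
keep short intervals to the right of a point. -/
theorem of_symbolic (h : IsOpen[L.symbolicTopology π] W) : IsRightOpen W := by
  induction h with
  | basic s hs =>
    obtain ⟨i, j, rfl | rfl⟩ := hs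
    · induction i with
      | zero => exact piece L j
      | succ i ih =>
        rw [Function.iterate_succ, Set.preimage_comp]
        exact ih.preimage_iet L π
    · induction i with
      | zero => rw [Function.iterate_zero, Set.image_id]; exact piece L j
      | succ i ih =>
        rw [Function.iterate_succ', Set.image_comp]
        exact ih.image_iet L π
  | univ => exact fun x _ => ⟨1, one_pos, fun _ _ _ => trivial⟩
  | inter s t _ _ hs ht => exact hs.inter ht
  | sUnion S _ hS =>
    rintro x ⟨s, hs, hx⟩
    obtain ⟨ε, hε, H⟩ := hS s hs x hx
    exact ⟨ε, hε, fun y hxy hy => ⟨s, hs, H y hxy hy⟩⟩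

theorem interior_nonempty (h : IsRightOpen W) (hne : W.Nonempty) : (interior W).Nonempty := by
  obtain ⟨x, hx⟩ := hne
  obtain ⟨ε, hε, H⟩ := h x hx
  have h1 := x.2.2
  have h0 := x.2.1
  have hmin : 0 < min ε (1 - x) := lt_min hε (sub_pos.2 h1)
  have hl := min_le_left ε (1 - x)
  have hr := min_le_right ε (1 - x)
  have hopen : IsOpen {y : UnitIco | (x : ℝ) < y ∧ (y : ℝ) < x + ε} :=
    (isOpen_lt continuous_const continuous_subtype_val).inter
      (isOpen_lt continuous_subtype_val continuous_const)
  refine ⟨⟨x + min ε (1 - x) / 2, by linarith, by linarith⟩,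
    interior_maximal (fun y hy => H y (le_of_lt hy.1) hy.2) hopen ⟨?_, ?_⟩⟩
  · change (x : ℝ) < x + min ε (1 - x) / 2
    linarith
  · change (x : ℝ) + min ε (1 - x) / 2 < x + ε
    linarith

end IsRightOpen

/-- Mixing for the standard topology implies mixing for the symbolic topology. -/
theorem TopologicallyMixing.symbolic {n : ℕ} {L : LengthVector n} {π : Equiv.Perm (Fin n)}
    (h : TopologicallyMixing (L.iet π)) :
    @TopologicallyMixing _ (L.symbolicTopology π) (L.iet π) := by
  intro U V hU hV hUne hVne
  obtain ⟨N, hN⟩ := h _ _ isOpen_interior isOpen_interior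
    ((IsRightOpen.of_symbolic L π hU).interior_nonempty hUne)
    ((IsRightOpen.of_symbolic L π hV).interior_nonempty hVne)
  exact ⟨N, fun k hk => (hN k hk).mono
    (Set.inter_subset_inter (Set.image_mono interior_subset) interior_subset)⟩

/-! ### The first stage and the assembly -/

section FirstStage

variable (L : LengthVector 4)

theorem leftEnd_eq_domStart (j : Fin 4) : L.leftEnd j = domStart L.1 j := by
  fin_cases j <;>
    simp [LengthVector.leftEnd, domStart, Finset.sum_filter, Fin.sum_univ_four, Fin.lt_def]

theorem sum_perm4213_eq_imgStart (j : Fin 4) :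
    ∑ k with perm4213 k < perm4213 j, L.1 k = imgStart L.1 j := by
  fin_cases j <;>
    simp [perm4213, imgStart, Finset.sum_filter, Fin.sum_univ_four, Fin.lt_def] <;> ring

theorem subPiece_zero_one (j : Fin 4) : subPiece 0 1 L.1 j = L.piece j := by
  ext x
  simp only [subPiece, orientedIco, LengthVector.piece, leftEnd_eq_domStart, Set.mem_ofPred_eq]
  constructor <;> rintro ⟨h1, h2⟩ <;> constructor <;> linarith

theorem inducedExchange_iet :
    InducedExchange (L.iet perm4213) 0 1 L.1 fun _ => 1 := by
  have hshift : ∀ j, ∀ x ∈ subPiece 0 1 L.1 j,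
      (L.iet perm4213 x : ℝ) = x + 1 * (imgStart L.1 j - domStart L.1 j) := by
    intro j x hx
    rw [subPiece_zero_one] at hx
    rw [L.iet_apply perm4213 hx, sum_perm4213_eq_imgStart, ← leftEnd_eq_domStart,
      LengthVector.leftEnd]
    ring
  refine ⟨Or.inl rfl, L.2.1, ?_, fun _ => one_pos, hshift, ?_, ?_⟩
  · have h := L.2.2
    rw [Fin.sum_univ_four] at h
    rintro x ⟨h1, h2⟩
    simp only [totalLength, h] at h1 h2
    constructor <;> linarith
  · intro j x _ t h0 h1
    omega
  · intro j x hx y hy t ht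
    interval_cases t
    · rfl
    · simp only [Function.iterate_one]
      rw [hshift j x hx, hshift j y hy]
      ring

end FirstStage

namespace KeaneSystem

variable {L : LengthVector 4} {m n : ℕ → ℕ} {len : ℕ → Fin 4 → ℝ}

theorem stagePiece_zero (h0 : len 0 = L.1) (j : Fin 4) : stagePiece len 0 j = L.piece j := by
  rw [← subPiece_zero_one, stagePiece, h0, pow_zero, stageOrigin]

theorem isOpen_stagePiece (H : KeaneSystem (L.iet perm4213) m n len) (h0 : len 0 = L.1)
    (k : ℕ) (j : Fin 4) : IsOpen[L.symbolicTopology perm4213] (stagePiece len k j) := by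
  induction k generalizing j with
  | zero =>
    rw [stagePiece_zero h0]
    exact L.isOpen_piece perm4213 j
  | succ k ih =>
    rw [stagePiece_succ]
    exact @InducedExchange.isOpen_subPiece_next _ _ _ _ _ _ _ _ (L.symbolicTopology perm4213)
      (L.continuous_iet perm4213) (H.stage k) (H.two_le_m k) (H.one_le_n k) (H.stage (k + 1)).pos
      (H.len_eq k) ih j

/-- Floors of late towers are arbitrarily short and symbolically open, since pieces are recognised
by finite codes and `T` is an open map. -/
theorem symbolicTopology_le (H : KeaneSystem (L.iet perm4213) m n len) (h0 : len 0 = L.1) :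
    L.symbolicTopology perm4213 ≤ (instTopologicalSpaceSubtype : TopologicalSpace UnitIco) := by
  intro W hW
  refine (@isOpen_iff_forall_mem_open UnitIco (L.symbolicTopology perm4213) W).2 fun x hx => ?_
  obtain ⟨k, j, t, -, hxt, hsub⟩ := H.exists_floor_subset hW hx
  exact ⟨_, hsub, L.isOpen_image_iterate_iet perm4213 (H.isOpen_stagePiece h0 k j) t, hxt⟩

theorem namedBefore_of_le {k : ℕ} {u s w s' w' : ℝ} {x y : UnitIco} (h : s + w ≤ s')
    (hx : (x : ℝ) ∈ orientedIco u ((-1) ^ k) s w) (hy : (y : ℝ) ∈ orientedIco u ((-1) ^ k) s' w') :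
    namedBefore k x y := by
  unfold namedBefore
  split_ifs with hk
  · rw [hk.neg_one_pow] at hx hy
    exact orientedIco.lt_of_le h hx hy
  · rw [(Nat.not_even_iff_odd.1 hk).neg_one_pow] at hx hy
    exact orientedIco.lt_of_le_neg h hx hy

/-- The stages of a Keane system form a Keane scheme. -/
def keaneScheme (H : KeaneSystem (L.iet perm4213) m n len) (h0 : len 0 = L.1) :
    KeaneScheme L m n where
  I := stagePiece len
  len := len
  b := returnTime m n
  one_le_m := H.one_le_m
  one_le_n := H.one_le_n
  I_zero := stagePiece_zero h0
  iUnion_succ k := by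
    rw [← H.stageBase_succ]
    exact (H.stage (k + 1)).iUnion_subPiece
  len_pos k := (H.stage k).pos
  isInterval k j := by
    have h := H.stage k
    have hj := h.pos j
    have hsub : orientedIco (stageOrigin len k) ((-1) ^ k) (domStart (len k) j) (len k j) ⊆
        Set.Ico 0 1 := by
      have h0 := h.pos 0
      have h1 := h.pos 1
      have h2 := h.pos 2
      have h3 := h.pos 3
      exact fun x hx => h.inside (orientedIco.mono (s' := 0) (w' := totalLength (len k)) h.sign
        (by fin_cases j <;> simp [domStart] <;> linarith)
        (by fin_cases j <;> simp [domStart, totalLength] <;> linarith) hx)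
    -- Midpoint minus half the length: the left end in either direction.
    set u := stageOrigin len k + (-1) ^ k * (domStart (len k) j + len k j / 2) - len k j / 2
      with hu
    have e : orientedIco (stageOrigin len k) ((-1) ^ k) (domStart (len k) j) (len k j) =
        Set.Ico u (u + len k j) := by
      ext x
      simp only [orientedIco, Set.mem_ofPred_eq, Set.mem_Ico, hu]
      constructor <;> rintro ⟨h1, h2⟩ <;> constructor <;> linarith
    rw [e, Set.Ico_subset_Ico_iff (by linarith)] at hsub
    refine ⟨u, hsub.1, hsub.2, ?_⟩
    rw [stagePiece, subPiece, e]
    rfl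
  ordered k i j hij x hx y hy := namedBefore_of_le ((H.stage k).domStart_add_le hij) hx hy
  firstReturn k j x hx := by
    have h := H.stage k
    have e : ⋃ i, stagePiece len k i = stageBase len k := h.iUnion_subPiece
    rw [e]
    refine ⟨⟨h.time_pos j, h.iterate_mem_base hx⟩, fun r hr => ?_⟩
    by_contra hlt
    exact h.no_return j x hx r hr.1 (not_le.1 hlt) hr.2
  translation k j := ⟨_, (H.stage k).shift j⟩
  exchange k i j hij x hx y hy := namedBefore_of_le ((H.stage k).imgStart_add_le hij)
    ((H.stage k).iterate_mem_image hx) ((H.stage k).iterate_mem_image hy)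
  len_eq := H.len_eq
  travel k i j x hx := by
    classical
    rw [stagePiece_succ] at hx
    rw [← (H.stage k).count_keane (H.one_le_m k) (H.one_le_n k) (H.stage (k + 1)).pos
      (H.len_eq k) hx i, Nat.count_eq_card_filter_range, ← Set.ncard_coe_finset]
    congr 1
    ext t
    simp [stagePiece, returnTime]

end KeaneSystem

theorem keaneConditions_returnTime {m n : ℕ → ℕ}
    (hadm : ∀ k, 1 ≤ k →
      Admissible (returnTime m n k) (∏ i ∈ Finset.Icc 1 k, returnTime m n i 1))
    (hg : ∀ k, 1 ≤ k →
      returnTime m n k 1 * returnTime m n (k + 1) 2 + returnTime m n (k + 1) 2 +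
          returnTime m n k 3 + returnTime m n (k - 1) 3 < m k * returnTime m n k 1 ∧
        returnTime m n k 2 * returnTime m n k 1 + returnTime m n k 1 <
          n k * returnTime m n k 2) : KeaneConditions m n (returnTime m n) where
  prime k hk := (hadm k hk).prime
  -- `b_{k,3}` is coprime to the whole product up to stage `k`, which contains `b_{i,2}`.
  not_dvd i k hi hik hdvd := by
    have h : returnTime m n i 1 ∣ ∏ i ∈ Finset.Icc 1 k, returnTime m n i 1 :=
      Finset.dvd_prod_of_mem (fun i => returnTime m n i 1) (Finset.mem_Icc.2 ⟨hi, hik.le⟩)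
    exact (hadm i hi).prime.one_lt.ne'
      (Nat.dvd_one.1 ((hadm k (by omega)).coprime.gcd_eq_one ▸ Nat.dvd_gcd hdvd h))
  units k hk := by
    have h := (hadm k hk).units
    have : NeZero (∏ i ∈ Finset.Icc 1 k, returnTime m n i 1) := ⟨fun h0 => by simp [h0] at h⟩
    rwa [Nat.card_eq_fintype_card, ZMod.card_units_eq_totient]
  growth_m k hk := (hg k hk).1
  growth_n k hk := (hg k hk).2

end

theorem theorem1 :
    ∃ (L : LengthVector 4) (m n : ℕ → ℕ) (K : KeaneScheme L m n),
      KeaneConditions m n K.b ∧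
      TopologicallyMixing (L.iet perm4213) ∧
      L.symbolicTopology perm4213 ≤ (instTopologicalSpaceSubtype : TopologicalSpace UnitIco) ∧
      @Continuous _ _ (L.symbolicTopology perm4213) (L.symbolicTopology perm4213)
        (L.iet perm4213) ∧
      @TopologicallyMixing _ (L.symbolicTopology perm4213) (L.iet perm4213) := by
  obtain ⟨m, n, hm, hn, hadm, hg⟩ := exists_admissible_parameters
  obtain ⟨len, hpos, hsum, hlen⟩ := exists_keane_lengths hm fun k => one_le_two.trans (hn k)
  let L : LengthVector 4 := ⟨len 0, hpos 0, hsum⟩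
  have H : KeaneSystem (L.iet perm4213) m n len :=
    KeaneSystem.of_first hm hn hpos hsum hlen (inducedExchange_iet L)
  have hmix := H.topologicallyMixing fun K hK => H.eventually_return hadm hg hK
  exact ⟨L, m, n, H.keaneScheme rfl, keaneConditions_returnTime hadm hg, hmix,
    H.symbolicTopology_le rfl, L.continuous_iet perm4213, hmix.symbolic⟩
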